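/- Let $\mathbb{F}=\mathbb{F}_2$, $R_x=\mathbb{F}[x]/(x^2)$ and $\Xi_x=\mathbb{F}[\xi_x,\xi_x^{-1}]/\xi_x\mathbb{F}[\xi_x]$. For an oriented tangle diagram $T$ in the disk with a finite set $\boldsymbol p$ of basepoints (of one colour $x$) on its edges, let $C_{\mathsf{BN}}(T)$ be Bar-Natan's complex over $\mathbb{F}$, with dotted cobordisms modulo the local relations (sphere $=0$, dotted sphere $=1$, two dots $=0$, neck cutting). Let $\rho(x)=\sum_{p\in\boldsymbol p}p$, where $p$ acts on $C_{\mathsf{BN}}(T)$ by a dot on the component containing $p$, and let $$\overline D_{\mathsf{BN}}(T,\boldsymbol p)=C_{\mathsf{BN}}(T)\otimes_{\mathbb F}R_x\otimes_{\mathbb F}\Xi_x,\qquad \partial=\partial_{C_{\mathsf{BN}}(T)}\otimes \mathrm{Id}\otimes \mathrm{Id}+(\rho(x)\otimes \mathrm{Id}+\mathrm{Id}\otimes x)\otimes\xi_x ,$$ with $R_x$ acting on the factor $R_x$. The enhanced map $\overline D_{\mathsf{BN}}$ of a movie is the composition of the enhanced maps of its elementary movies. A Reidemeister or Morse movie $\Sigma$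 with vertical decoration away from the move gives $C_{\mathsf{BN}}(\Sigma)\otimes\mathrm{Id}\otimes\mathrm{Id}$; a cup (cap) movie, which adds (removes) two basepoints joined by a short arc without crossings, gives the identity; sliding a basepoint along its strand through a crossing $c$ gives $\mathrm{Id}+H_c\otimes \mathrm{Id}_{R_x}\otimes\xi_x$, where $H_c$ is the sum of the saddles that change the $1$-resolution of $c$ to the $0$-resolution. Let $T$ be any oriented tangle diagram and let $s$ be an edge of $T$. Let $((I\times T)\#\mathbb{RP}^2,\mathbb{RP}^1):(T,\emptyset)\to(T,\emptyset)$ be the decorated cobordism which is the connected sum, at $s$, with the standard $\mathbb{RP}^2$ with Euler number $-2$, decorated by the core $\mathbb{RP}^1$ in the colour $x$. It is given by the following movie: 1. a Reidemeister I movie adds a negative kink to $s$, on either side of $s$; the map on $C_{\mathsf{BN}}$ is the birth of the circle in the $1$-resolution of the new crossing $c$; 2. a cup movie adds two basepoints on the loop of the kink, near $c$, on the two sides of the foot of a band; 3. a Morse movie along that band, whose other foot is on the edge at which the kink is left, or on the edge at which it is entered, turns the kink into a positive one; 4. one of the two basepoints slides through $c$, after which it is next to the other one; 5. a cap movie removes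 the two basepoints; 6. a Reidemeister I movie removes the positive kink; the map on $C_{\mathsf{BN}}$ is the death of the circle in the $0$-resolution of $c$. Then, for each of these movies, $$\overline D_{\mathsf{BN}}((I\times T)\#\mathbb{RP}^2,\mathbb{RP}^1):C_{\mathsf{BN}}(T)\otimes_{\mathbb F}R_x\otimes_{\mathbb F}\Xi_x\to C_{\mathsf{BN}}(T)\otimes_{\mathbb F}R_x\otimes_{\mathbb F}\Xi_x$$ is equal to $\mathrm{Id}\otimes\mathrm{Id}\otimes\xi_x$, multiplication by $\xi_x$ (an equality of maps, not only up to homotopy), and it is an $R_x$-linear chain map. -/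

import Mathlib

open CategoryTheory TensorProduct

namespace BNTangle

noncomputable section

/-! ## One-manifolds in the disk -/

/-- A compact `1`-manifold with `2 * n` boundary points, cut into finitely many oriented segments.
The boundary points are the sources `+0, …, +(n-1)` and the sinks `-0, …, -(n-1)`.
`X` is the set of interior cutting points; every segment starts at an element of `X` or at a
source, and `next` sends it to its end, an element of `X` or a sink.  -/
structure Smoothing (n : ℕ) where
  X : Type
  [fintype : Fintype X]
  [decEq : DecidableEq X]
  next : X ⊕ Fin n ≃ X ⊕ Fin n

attribute [instance] Smoothing.fintype Smoothing.decEq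

namespace Smoothing

variable {n : ℕ}

/-- The segments, named by their starting points. -/
abbrev Seg (a : Smoothing n) : Type := a.X ⊕ Fin n

/-- The segment `t` starts at the cutting point at which the segment `s` ends. -/
def Follows (a : Smoothing n) (s t : a.Seg) : Prop :=
  ∃ x : a.X, a.next s = Sum.inl x ∧ t = Sum.inl x

/-- The connected components. -/
def Comp (a : Smoothing n) : Type := Quot a.Follows

/-- The component containing a segment. -/
def comp (a : Smoothing n) (s : a.Seg) : a.Comp := Quot.mk _ s

/-- The Euler characteristics of the components: `1` for each of the `n` arcs, `0` for circles. -/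
def euler (a : Smoothing n) : a.Comp →₀ ℤ :=
  ∑ i : Fin n, Finsupp.single (a.comp (Sum.inr i)) 1

/-- Extends a map by fixing a new point `none`. -/
def addCircleMap {X : Type} (f : X ⊕ Fin n → X ⊕ Fin n) : Option X ⊕ Fin n → Option X ⊕ Fin n
  | Sum.inl none => Sum.inl none
  | Sum.inl (some x) => (f (Sum.inl x)).map some id
  | Sum.inr i => (f (Sum.inr i)).map some id

theorem addCircleMap_map {X : Type} (f : X ⊕ Fin n → X ⊕ Fin n) (s : X ⊕ Fin n) :
    addCircleMap f (s.map some id) = (f s).map some id := by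
  rcases s with x | i <;> rfl

/-- The disjoint union with a circle (which is a single segment). -/
def addCircle (a : Smoothing n) : Smoothing n where
  X := Option a.X
  next :=
    { toFun := addCircleMap a.next
      invFun := addCircleMap a.next.symm
      left_inv := by
        rintro ((_ | x) | i)
        · rfl
        · show addCircleMap a.next.symm (Sum.map some id (a.next (Sum.inl x))) = _
          rw [addCircleMap_map]; simp
        · show addCircleMap a.next.symm (Sum.map some id (a.next (Sum.inr i))) = _
          rw [addCircleMap_map]; simp
      right_inv := by
        rintro ((_ | x) | i)
        · rfl
        · show addCircleMap a.next (Sum.map some id (a.next.symm (Sum.inl x))) = _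
          rw [addCircleMap_map]; simp
        · show addCircleMap a.next (Sum.map some id (a.next.symm (Sum.inr i))) = _
          rw [addCircleMap_map]; simp }

/-- The new circle. -/
def newCircle (a : Smoothing n) : a.addCircle.Comp := a.addCircle.comp (Sum.inl none)

/-- The old components inside the disjoint union with a circle. -/
def toAddCircle (a : Smoothing n) : a.Comp → a.addCircle.Comp :=
  Quot.map (Sum.map some id) (by
    rintro s t ⟨x, hx, rfl⟩
    exact ⟨some x, by
      show addCircleMap a.next (Sum.map some id s) = _
      rw [addCircleMap_map, hx]; rfl, rfl⟩)

end Smoothing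

/-! ## Dotted cobordisms -/

variable {n : ℕ}

/-- The invariants of a dotted cobordism `Σ` from `a` to `b`: the set `S` of its connected
components, the maps sending a component of `a` or `b` to the component of `Σ` containing it, and
the Euler characteristic and the number of dots of each component. -/
structure PreCob (a b : Smoothing n) where
  S : Type
  source : a.Comp → S
  target : b.Comp → S
  euler : S →₀ ℤ
  dots : S →₀ ℕ

namespace PreCob

/-- Equality of the invariants up to renaming the components. -/
def Equivalent {a b : Smoothing n} (f g : PreCob a b) : Prop :=
  ∃ e : f.S ≃ g.S, (∀ p, e (f.source p) = g.source p) ∧ (∀ p, e (f.target p) = g.target p) ∧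
    f.euler.mapDomain e = g.euler ∧ f.dots.mapDomain e = g.dots

instance setoid (a b : Smoothing n) : Setoid (PreCob a b) where
  r := Equivalent
  iseqv :=
    { refl := fun f => ⟨Equiv.refl _, fun _ => rfl, fun _ => rfl, by simp, by simp⟩
      symm := by
        rintro f g ⟨e, h1, h2, h3, h4⟩
        refine ⟨e.symm, fun p => by simp [← h1], fun p => by simp [← h2], ?_, ?_⟩
        · rw [← h3, ← Finsupp.mapDomain_comp]; simp
        · rw [← h4, ← Finsupp.mapDomain_comp]; simp
      trans := by
        rintro f g h ⟨e, h1, h2, h3, h4⟩ ⟨e', h1', h2', h3', h4'⟩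
        refine ⟨e.trans e', fun p => by simp [h1, h1'], fun p => by simp [h2, h2'], ?_, ?_⟩
        · rw [← h3', ← h3, ← Finsupp.mapDomain_comp]; rfl
        · rw [← h4', ← h4, ← Finsupp.mapDomain_comp]; rfl }

/-- The identity cobordism `I × a`. -/
def id (a : Smoothing n) : PreCob a a where
  S := a.Comp
  source := fun p => p
  target := fun p => p
  euler := a.euler
  dots := 0

/-- The components of `Σ ∪ Σ'`, glued along `b`. -/
def GlueRel {a b c : Smoothing n} (f : PreCob a b) (g : PreCob b c) (s t : f.S ⊕ g.S) : Prop :=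
  ∃ p : b.Comp, s = Sum.inl (f.target p) ∧ t = Sum.inr (g.source p)

/-- Gluing two cobordisms along `b`; Euler characteristics are additive, except that `b` is counted
twice. -/
def comp {a b c : Smoothing n} (f : PreCob a b) (g : PreCob b c) : PreCob a c where
  S := Quot (GlueRel f g)
  source := fun p => Quot.mk _ (Sum.inl (f.source p))
  target := fun p => Quot.mk _ (Sum.inr (g.target p))
  euler := f.euler.mapDomain (fun s => Quot.mk _ (Sum.inl s)) +
    g.euler.mapDomain (fun s => Quot.mk _ (Sum.inr s)) -
    b.euler.mapDomain (fun p => Quot.mk _ (Sum.inl (f.target p)))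
  dots := f.dots.mapDomain (fun s => Quot.mk _ (Sum.inl s)) +
    g.dots.mapDomain (fun s => Quot.mk _ (Sum.inr s))

theorem glue {a b c : Smoothing n} (f : PreCob a b) (g : PreCob b c) (p : b.Comp) :
    (Quot.mk _ (Sum.inl (f.target p)) : Quot (GlueRel f g)) = Quot.mk _ (Sum.inr (g.source p)) :=
  Quot.sound ⟨p, rfl, rfl⟩

theorem comp_congr {a b c : Smoothing n} {f f' : PreCob a b} {g g' : PreCob b c}
    (hf : f ≈ f') (hg : g ≈ g') : comp f g ≈ comp f' g' := by
  obtain ⟨e, h1, h2, h3, h4⟩ := hf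
  obtain ⟨d, k1, k2, k3, k4⟩ := hg
  let E : Quot (GlueRel f g) ≃ Quot (GlueRel f' g') :=
    Quot.congr (Equiv.sumCongr e d) (by
      rintro s t
      constructor
      · rintro ⟨p, rfl, rfl⟩
        exact ⟨p, by simp [h2], by simp [k1]⟩
      · rintro ⟨p, hs, ht⟩
        refine ⟨p, (Equiv.sumCongr e d).injective ?_, (Equiv.sumCongr e d).injective ?_⟩
        · rw [hs]; simp [h2]
        · rw [ht]; simp [k1])
  have el : E ∘ (fun s => Quot.mk _ (Sum.inl s)) = (fun s => Quot.mk _ (Sum.inl s)) ∘ e := rfl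
  have er : E ∘ (fun s => Quot.mk _ (Sum.inr s)) = (fun s => Quot.mk _ (Sum.inr s)) ∘ d := rfl
  have eb : E ∘ (fun p => Quot.mk _ (Sum.inl (f.target p))) =
      (fun p => Quot.mk _ (Sum.inl (f'.target p))) := by
    funext p
    show Quot.mk _ (Sum.inl (e (f.target p))) = _
    rw [h2]
  refine ⟨E, fun p => ?_, fun p => ?_, ?_, ?_⟩
  · show Quot.mk _ (Sum.inl (e (f.source p))) = Quot.mk _ (Sum.inl (f'.source p))
    rw [h1]
  · show Quot.mk _ (Sum.inr (d (g.target p))) = Quot.mk _ (Sum.inr (g'.target p))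
    rw [k2]
  · show Finsupp.mapDomain E (_ + _ - _) = _ + _ - _
    rw [sub_eq_add_neg, sub_eq_add_neg, Finsupp.mapDomain_add, Finsupp.mapDomain_add,
      ← Finsupp.mapDomain.addMonoidHom_apply E (-_), map_neg,
      Finsupp.mapDomain.addMonoidHom_apply, ← Finsupp.mapDomain_comp, ← Finsupp.mapDomain_comp,
      ← Finsupp.mapDomain_comp, el, er, eb, Finsupp.mapDomain_comp, h3, Finsupp.mapDomain_comp, k3]
  · show Finsupp.mapDomain E (_ + _) = _ + _
    rw [Finsupp.mapDomain_add, ← Finsupp.mapDomain_comp, ← Finsupp.mapDomain_comp, el, er,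
      Finsupp.mapDomain_comp, h4, Finsupp.mapDomain_comp, k4]

theorem mapDomain_sub {S T : Type} (φ : S → T) (u v : S →₀ ℤ) :
    (u - v).mapDomain φ = u.mapDomain φ - v.mapDomain φ := by
  simpa using map_sub (Finsupp.mapDomain.addMonoidHom φ) u v

/-- A way to recognize a composition. -/
theorem comp_equivalent {a b c : Smoothing n} (f : PreCob a b) (g : PreCob b c) (h : PreCob a c)
    (u : f.S → h.S) (v : g.S → h.S) (huv : ∀ p, u (f.target p) = v (g.source p))
    (w : h.S → Quot (GlueRel f g)) (hwu : ∀ s, w (u s) = Quot.mk _ (Sum.inl s))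
    (hwv : ∀ s, w (v s) = Quot.mk _ (Sum.inr s)) (hw : ∀ s, (∃ t, u t = s) ∨ ∃ t, v t = s)
    (hs : ∀ p, u (f.source p) = h.source p) (ht : ∀ p, v (g.target p) = h.target p)
    (he : f.euler.mapDomain u + g.euler.mapDomain v - b.euler.mapDomain (fun p => u (f.target p))
      = h.euler)
    (hd : f.dots.mapDomain u + g.dots.mapDomain v = h.dots) : comp f g ≈ h := by
  let E : Quot (GlueRel f g) ≃ h.S :=
    { toFun := Quot.lift (Sum.elim u v) (by rintro _ _ ⟨p, rfl, rfl⟩; exact huv p)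
      invFun := w
      left_inv := by
        rintro ⟨s | s⟩
        · exact hwu s
        · exact hwv s
      right_inv := by
        intro s
        rcases hw s with ⟨t, rfl⟩ | ⟨t, rfl⟩
        · rw [hwu]; rfl
        · rw [hwv]; rfl }
  refine ⟨E, hs, ht, ?_, ?_⟩
  · rw [← he]
    show Finsupp.mapDomain E (_ + _ - _) = _
    rw [mapDomain_sub, Finsupp.mapDomain_add, ← Finsupp.mapDomain_comp, ← Finsupp.mapDomain_comp,
      ← Finsupp.mapDomain_comp]
    rfl
  · rw [← hd]
    show Finsupp.mapDomain E (_ + _) = _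
    rw [Finsupp.mapDomain_add, ← Finsupp.mapDomain_comp, ← Finsupp.mapDomain_comp]
    rfl

theorem id_comp {a b : Smoothing n} (f : PreCob a b) : comp (id a) f ≈ f := by
  refine comp_equivalent (id a) f f f.source (fun s => s) (fun _ => rfl)
    (fun s => Quot.mk _ (Sum.inr s)) (fun p => (glue (id a) f p).symm) (fun _ => rfl)
    (fun s => Or.inr ⟨s, rfl⟩) (fun _ => rfl) (fun _ => rfl) ?_ ?_
  · show a.euler.mapDomain f.source + f.euler.mapDomain _root_.id - a.euler.mapDomain f.source = _
    rw [Finsupp.mapDomain_id]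
    abel
  · show Finsupp.mapDomain f.source (0 : a.Comp →₀ ℕ) + f.dots.mapDomain _root_.id = _
    rw [Finsupp.mapDomain_id, Finsupp.mapDomain_zero, zero_add]

theorem comp_id {a b : Smoothing n} (f : PreCob a b) : comp f (id b) ≈ f := by
  refine comp_equivalent f (id b) f (fun s => s) f.target (fun _ => rfl)
    (fun s => Quot.mk _ (Sum.inl s)) (fun _ => rfl) (fun p => glue f (id b) p)
    (fun s => Or.inl ⟨s, rfl⟩) (fun _ => rfl) (fun _ => rfl) ?_ ?_
  · show f.euler.mapDomain _root_.id + b.euler.mapDomain f.target - b.euler.mapDomain f.target = _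
    rw [Finsupp.mapDomain_id]
    abel
  · show f.dots.mapDomain _root_.id + Finsupp.mapDomain f.target (0 : b.Comp →₀ ℕ) = _
    rw [Finsupp.mapDomain_id, Finsupp.mapDomain_zero, add_zero]

theorem assoc {a b c d : Smoothing n} (f : PreCob a b) (g : PreCob b c) (h : PreCob c d) :
    comp (comp f g) h ≈ comp f (comp g h) := by
  let q : g.S ⊕ h.S → (comp g h).S := Quot.mk _
  let r : f.S ⊕ (comp g h).S → (comp f (comp g h)).S := Quot.mk _
  let q' : f.S ⊕ g.S → (comp f g).S := Quot.mk _
  let r' : (comp f g).S ⊕ h.S → (comp (comp f g) h).S := Quot.mk _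
  let u : (comp f g).S → (comp f (comp g h)).S :=
    Quot.lift (Sum.elim (fun s => r (Sum.inl s)) (fun s => r (Sum.inr (q (Sum.inl s)))))
      (by rintro _ _ ⟨p, rfl, rfl⟩; exact glue f (comp g h) p)
  let v : h.S → (comp f (comp g h)).S := fun s => r (Sum.inr (q (Sum.inr s)))
  let w : (comp f (comp g h)).S → (comp (comp f g) h).S :=
    Quot.lift (Sum.elim (fun s => r' (Sum.inl (q' (Sum.inl s))))
      (Quot.lift (Sum.elim (fun s => r' (Sum.inl (q' (Sum.inr s)))) (fun s => r' (Sum.inr s)))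
        (by rintro _ _ ⟨p, rfl, rfl⟩; exact glue (comp f g) h p)))
      (by rintro _ _ ⟨p, rfl, rfl⟩
          exact congrArg (fun z => r' (Sum.inl z)) (glue f g p))
  have hu1 : u ∘ (fun s => q' (Sum.inl s)) = fun s => r (Sum.inl s) := rfl
  have hu2 : u ∘ (fun s => q' (Sum.inr s)) = (fun z => r (Sum.inr z)) ∘ fun s => q (Sum.inl s) := rfl
  have hu3 : u ∘ (fun p => q' (Sum.inl (f.target p))) = fun p => r (Sum.inl (f.target p)) := rfl
  have hu4 : (fun p => u ((comp f g).target p)) =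
    (fun z => r (Sum.inr z)) ∘ fun p => q (Sum.inl (g.target p)) := rfl
  have hv : v = (fun z => r (Sum.inr z)) ∘ fun s => q (Sum.inr s) := rfl
  have eE : (comp f g).euler = f.euler.mapDomain (fun s => q' (Sum.inl s)) +
    g.euler.mapDomain (fun s => q' (Sum.inr s)) -
    b.euler.mapDomain (fun p => q' (Sum.inl (f.target p))) := rfl
  have eE' : (comp g h).euler = g.euler.mapDomain (fun s => q (Sum.inl s)) +
    h.euler.mapDomain (fun s => q (Sum.inr s)) -
    c.euler.mapDomain (fun p => q (Sum.inl (g.target p))) := rfl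
  have eE'' : (comp f (comp g h)).euler = f.euler.mapDomain (fun s => r (Sum.inl s)) +
    (comp g h).euler.mapDomain (fun s => r (Sum.inr s)) -
    b.euler.mapDomain (fun p => r (Sum.inl (f.target p))) := rfl
  have eD : (comp f g).dots = f.dots.mapDomain (fun s => q' (Sum.inl s)) +
    g.dots.mapDomain (fun s => q' (Sum.inr s)) := rfl
  have eD' : (comp g h).dots = g.dots.mapDomain (fun s => q (Sum.inl s)) +
    h.dots.mapDomain (fun s => q (Sum.inr s)) := rfl
  have eD'' : (comp f (comp g h)).dots = f.dots.mapDomain (fun s => r (Sum.inl s)) +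
    (comp g h).dots.mapDomain (fun s => r (Sum.inr s)) := rfl
  refine comp_equivalent (comp f g) h (comp f (comp g h)) u v
    (fun p => congrArg (fun z => r (Sum.inr z)) (glue g h p)) w ?_ (fun _ => rfl) ?_
    (fun _ => rfl) (fun _ => rfl) ?_ ?_
  · intro s
    induction s using Quot.ind with | _ s => rcases s with s | s <;> rfl
  · intro s
    induction s using Quot.ind with | _ s =>
    rcases s with s | s
    · exact Or.inl ⟨q' (Sum.inl s), rfl⟩
    · induction s using Quot.ind with | _ s =>
      rcases s with s | s
      · exact Or.inl ⟨q' (Sum.inr s), rfl⟩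
      · exact Or.inr ⟨s, rfl⟩
  · rw [eE, eE'', eE', mapDomain_sub, mapDomain_sub, Finsupp.mapDomain_add, Finsupp.mapDomain_add,
      ← Finsupp.mapDomain_comp, ← Finsupp.mapDomain_comp, ← Finsupp.mapDomain_comp,
      ← Finsupp.mapDomain_comp, ← Finsupp.mapDomain_comp, ← Finsupp.mapDomain_comp,
      hu1, hu2, hu3, hu4, hv]
    abel
  · rw [eD, eD'', eD', Finsupp.mapDomain_add, Finsupp.mapDomain_add,
      ← Finsupp.mapDomain_comp, ← Finsupp.mapDomain_comp, ← Finsupp.mapDomain_comp,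
      ← Finsupp.mapDomain_comp, hu1, hu2, hv]
    abel

/-- The cylinder of a homeomorphism rel boundary from `a` to `b`, or rather of the bijection `φ`
of components which it induces: `φ` fixes the sources and the sinks of the arcs. -/
def cylinder (a b : Smoothing n) (φ : a.Comp ≃ b.Comp) : PreCob a b where
  S := b.Comp
  source := φ
  target := fun p => p
  euler := b.euler
  dots := 0

/-- `I × a` with one dot on the component `I × p`. -/
def dot (a : Smoothing n) (p : a.Comp) : PreCob a a where
  S := a.Comp
  source := fun q => q
  target := fun q => q
  euler := a.euler
  dots := Finsupp.single p 1

/-- The birth of a circle: the disjoint union of `I × a` and a disk. -/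
def birth (a : Smoothing n) : PreCob a a.addCircle where
  S := a.addCircle.Comp
  source := a.toAddCircle
  target := fun p => p
  euler := a.addCircle.euler + Finsupp.single a.newCircle 1
  dots := 0

/-- The death of a circle: the disjoint union of `I × a` and a disk. -/
def death (a : Smoothing n) : PreCob a.addCircle a where
  S := a.addCircle.Comp
  source := fun p => p
  target := a.toAddCircle
  euler := a.addCircle.euler + Finsupp.single a.newCircle 1
  dots := 0

end PreCob

/-- The result of an oriented surgery along a band joining the segments `s ≠ t`: the two segments
exchange their ends. -/
structure IsSurgery {X : Type} (f g : X ⊕ Fin n ≃ X ⊕ Fin n) (s t : X ⊕ Fin n) : Prop where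
  ne : s ≠ t
  left : g s = f t
  right : g t = f s
  other : ∀ u, u ≠ s → u ≠ t → g u = f u

namespace PreCob

/-- The components of the union of `I × a` and a band joining the segments `s` and `t`. -/
def SaddleRel (a : Smoothing n) (s t u v : a.Seg) : Prop :=
  a.Follows u v ∨ (u = s ∧ v = t)

/-- The saddle: `I × a` with a band attached along the segments `s` and `t` of `a`. -/
def saddle {X : Type} [Fintype X] [DecidableEq X] (f g : X ⊕ Fin n ≃ X ⊕ Fin n)
    (s t : X ⊕ Fin n) (h : IsSurgery f g s t) : PreCob ⟨X, f⟩ ⟨X, g⟩ where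
  S := Quot (SaddleRel ⟨X, f⟩ s t)
  source := Quot.map (fun u => u) (fun _ _ huv => Or.inl huv)
  target := Quot.lift (fun u => Quot.mk _ u) (by
    have hst : (Quot.mk (SaddleRel ⟨X, f⟩ s t) s) = Quot.mk _ t := Quot.sound (Or.inr ⟨rfl, rfl⟩)
    rintro u v ⟨x, hx, rfl⟩
    change g u = Sum.inl x at hx
    by_cases hs : u = s
    · subst hs
      rw [h.left] at hx
      rw [hst]
      exact Quot.sound (Or.inl ⟨x, hx, rfl⟩)
    by_cases ht : u = t
    · subst ht
      rw [h.right] at hx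
      rw [← hst]
      exact Quot.sound (Or.inl ⟨x, hx, rfl⟩)
    rw [h.other u hs ht] at hx
    exact Quot.sound (Or.inl ⟨x, hx, rfl⟩))
  euler := (Smoothing.euler ⟨X, f⟩).mapDomain (Quot.map (fun u => u) (fun _ _ huv => Or.inl huv)) -
    Finsupp.single (Quot.mk _ s) 1
  dots := 0

end PreCob

/-- Invariants of dotted cobordisms, up to renaming the components. -/
def VirtCob (a b : Smoothing n) : Type 1 := Quotient (PreCob.setoid a b)

namespace VirtCob

def id (a : Smoothing n) : VirtCob a a := ⟦PreCob.id a⟧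

def comp {a b c : Smoothing n} (f : VirtCob a b) (g : VirtCob b c) : VirtCob a c :=
  Quotient.liftOn₂ f g (fun f g => ⟦PreCob.comp f g⟧)
    (fun _ _ _ _ hf hg => Quotient.sound (PreCob.comp_congr hf hg))

/-- The dotted cobordisms: finite compositions of the elementary ones of Morse theory (isotopies,
dots, births, deaths, and saddles compatible with the orientations). -/
inductive IsCobordism : ∀ {a b : Smoothing n}, VirtCob a b → Prop
  | id (a : Smoothing n) : IsCobordism (id a)
  | comp {a b c : Smoothing n} (f : VirtCob a b) (g : VirtCob b c) :
      IsCobordism f → IsCobordism g → IsCobordism (comp f g)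
  | cylinder (a b : Smoothing n) (φ : a.Comp ≃ b.Comp)
      (hsource : ∀ i, φ (a.comp (Sum.inr i)) = b.comp (Sum.inr i))
      (hsink : ∀ i, φ (a.comp (a.next.symm (Sum.inr i))) = b.comp (b.next.symm (Sum.inr i))) :
      IsCobordism ⟦PreCob.cylinder a b φ⟧
  | dot (a : Smoothing n) (p : a.Comp) : IsCobordism ⟦PreCob.dot a p⟧
  | birth (a : Smoothing n) : IsCobordism ⟦PreCob.birth a⟧
  | death (a : Smoothing n) : IsCobordism ⟦PreCob.death a⟧
  | saddle {X : Type} [Fintype X] [DecidableEq X] (f g : X ⊕ Fin n ≃ X ⊕ Fin n)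
      (s t : X ⊕ Fin n) (h : IsSurgery f g s t) : IsCobordism ⟦PreCob.saddle f g s t h⟧

end VirtCob

/-- The category of dotted cobordisms rel boundary. Its objects are one-manifolds with `2 * n`
boundary points. A dotted cobordism is oriented, and is considered up to homeomorphism rel boundary
and up to moving dots inside a component, hence determined by its invariants. -/
instance cobCategory : Category (Smoothing n) where
  Hom a b := { f : VirtCob a b // f.IsCobordism }
  id a := ⟨VirtCob.id a, .id a⟩
  comp f g := ⟨VirtCob.comp f.1 g.1, .comp _ _ f.2 g.2⟩
  id_comp := by
    rintro a b ⟨f, hf⟩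
    refine Subtype.ext ?_
    induction f using Quotient.inductionOn with | _ f =>
    exact Quotient.sound (PreCob.id_comp f)
  comp_id := by
    rintro a b ⟨f, hf⟩
    refine Subtype.ext ?_
    induction f using Quotient.inductionOn with | _ f =>
    exact Quotient.sound (PreCob.comp_id f)
  assoc := by
    rintro a b c d ⟨f, hf⟩ ⟨g, hg⟩ ⟨h, hh⟩
    refine Subtype.ext ?_
    induction f using Quotient.inductionOn with | _ f =>
    induction g using Quotient.inductionOn with | _ g =>
    induction h using Quotient.inductionOn with | _ h =>
    exact Quotient.sound (PreCob.assoc f g h)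

namespace Cob

def cylinder (a b : Smoothing n) (φ : a.Comp ≃ b.Comp)
    (hsource : ∀ i, φ (a.comp (Sum.inr i)) = b.comp (Sum.inr i))
    (hsink : ∀ i, φ (a.comp (a.next.symm (Sum.inr i))) = b.comp (b.next.symm (Sum.inr i))) :
    a ⟶ b :=
  ⟨⟦PreCob.cylinder a b φ⟧, .cylinder a b φ hsource hsink⟩

def dot (a : Smoothing n) (p : a.Comp) : a ⟶ a := ⟨⟦PreCob.dot a p⟧, .dot a p⟩

def birth (a : Smoothing n) : a ⟶ a.addCircle := ⟨⟦PreCob.birth a⟧, .birth a⟩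

def death (a : Smoothing n) : a.addCircle ⟶ a := ⟨⟦PreCob.death a⟧, .death a⟩

def saddle {X : Type} [Fintype X] [DecidableEq X] (f g : X ⊕ Fin n ≃ X ⊕ Fin n)
    (s t : X ⊕ Fin n) (h : IsSurgery f g s t) : (⟨X, f⟩ : Smoothing n) ⟶ ⟨X, g⟩ :=
  ⟨⟦PreCob.saddle f g s t h⟧, .saddle f g s t h⟩

end Cob

/-! ## The Bar-Natan category -/

/-- The field with two elements. -/
abbrev F₂ : Type := ZMod 2

/-- Formal `F₂`-linear combinations of dotted cobordisms. -/
abbrev LinCob (n : ℕ) : Type 1 := Free F₂ (Smoothing n)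

/-- A dotted cobordism as a formal linear combination. -/
def lin {a b : Smoothing n} (f : a ⟶ b) : Free.of F₂ a ⟶ Free.of F₂ b :=
  (Free.embedding F₂ (Smoothing n)).map f

/-- Bar-Natan's local relations for dotted cobordisms: a sphere is `0`, a sphere with one dot can be
removed, two dots on one component give `0`, and a neck can be cut. They generate a linear
congruence. -/
inductive LocalRel : ∀ ⦃a b : LinCob n⦄, (a ⟶ b) → (a ⟶ b) → Prop
  | sphere (a : Smoothing n) : LocalRel (lin (Cob.birth a ≫ Cob.death a)) 0
  | dottedSphere (a : Smoothing n) :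
      LocalRel (lin (Cob.birth a ≫ Cob.dot a.addCircle a.newCircle ≫ Cob.death a)) (lin (𝟙 a))
  | twoDots (a : Smoothing n) (p : a.Comp) : LocalRel (lin (Cob.dot a p ≫ Cob.dot a p)) 0
  | neck (a : Smoothing n) :
      LocalRel (lin (𝟙 a.addCircle))
        (lin (Cob.dot a.addCircle a.newCircle ≫ Cob.death a ≫ Cob.birth a) +
          lin (Cob.death a ≫ Cob.birth a ≫ Cob.dot a.addCircle a.newCircle))
  | refl {a b : LinCob n} (f : a ⟶ b) : LocalRel f f
  | symm {a b : LinCob n} {f g : a ⟶ b} : LocalRel f g → LocalRel g f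
  | trans {a b : LinCob n} {f g h : a ⟶ b} : LocalRel f g → LocalRel g h → LocalRel f h
  | comp_left {a b c : LinCob n} (f : a ⟶ b) {g g' : b ⟶ c} :
      LocalRel g g' → LocalRel (f ≫ g) (f ≫ g')
  | comp_right {a b c : LinCob n} {f f' : a ⟶ b} (g : b ⟶ c) :
      LocalRel f f' → LocalRel (f ≫ g) (f' ≫ g)
  | add {a b : LinCob n} {f f' g g' : a ⟶ b} :
      LocalRel f f' → LocalRel g g' → LocalRel (f + g) (f' + g')
  | smul {a b : LinCob n} (r : F₂) {f f' : a ⟶ b} : LocalRel f f' → LocalRel (r • f) (r • f')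

/-- The congruence generated by Bar-Natan's local relations. -/
def localRel (n : ℕ) : HomRel (LinCob n) := fun _ _ f g => LocalRel f g

instance : Congruence (localRel n) where
  equivalence := ⟨LocalRel.refl, LocalRel.symm, LocalRel.trans⟩
  comp_left f _ _ h := LocalRel.comp_left f h
  comp_right g h := LocalRel.comp_right g h

/-- The `F₂`-linear category of dotted cobordisms modulo the local relations. -/
abbrev LocCob (n : ℕ) : Type 1 := CategoryTheory.Quotient (localRel n)

instance : Preadditive (LocCob n) :=
  Quotient.preadditive (localRel n) (fun _ _ _ _ _ _ h h' => LocalRel.add h h')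

instance : (Quotient.functor (localRel n)).Additive :=
  Quotient.functor_additive (localRel n) (fun _ _ _ _ _ _ h h' => LocalRel.add h h')

instance : Linear F₂ (LocCob n) :=
  Quotient.linear F₂ (localRel n) (fun r _ _ _ _ h => LocalRel.smul r h)

/-- A one-manifold as an object of `LocCob`. -/
abbrev toLoc (a : Smoothing n) : LocCob n := ⟨a⟩

/-- The class of a dotted cobordism. -/
def cls {a b : Smoothing n} (f : a ⟶ b) : toLoc a ⟶ toLoc b :=
  (Quotient.functor (localRel n)).map (lin f)

/-! ## Bigraded vector spaces and the additive enlargement -/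

/-- A `(h, q)`-bigraded `F₂`-vector space, given with a basis of homogeneous elements. -/
structure GrVect where
  carrier : Type
  [addCommGroup : AddCommGroup carrier]
  [module : Module F₂ carrier]
  I : Type
  basis : Module.Basis I F₂ carrier
  deg : I → ℤ × ℤ

attribute [instance] GrVect.addCommGroup GrVect.module

namespace GrVect

/-- The field `F₂` placed in one bidegree. -/
def line (d : ℤ × ℤ) : GrVect where
  carrier := F₂
  I := Unit
  basis := Module.Basis.singleton Unit F₂
  deg := fun _ => d

/-- The tensor product over `F₂`. -/
def tensor (V W : GrVect) : GrVect where
  carrier := V.carrier ⊗[F₂] W.carrier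
  I := V.I × W.I
  basis := V.basis.tensorProduct W.basis
  deg := fun i => V.deg i.1 + W.deg i.2

end GrVect

/-- The objects `X ⊗ V`, for a one-manifold `X` and a bigraded vector space `V`. -/
structure TensObj (n : ℕ) where
  X : LocCob n
  V : GrVect

/-- Morphisms `X ⊗ V ⟶ Y ⊗ W` are elements of `Hom(X, Y) ⊗ Hom(V, W)`; they need not be
homogeneous. -/
instance tensCategory : Category (TensObj n) where
  Hom A B := (A.X ⟶ B.X) ⊗[F₂] (A.V.carrier →ₗ[F₂] B.V.carrier)
  id A := 𝟙 A.X ⊗ₜ LinearMap.id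
  comp {A B C} f g := TensorProduct.map₂ (Linear.comp (S := F₂) A.X B.X C.X)
    (LinearMap.llcomp F₂ A.V.carrier B.V.carrier C.V.carrier).flip f g
  id_comp {A B} f := by
    induction f using TensorProduct.induction_on with
    | zero => simp
    | tmul u φ => simp; rfl
    | add f g hf hg => rw [map_add, hf, hg]
  comp_id {A B} f := by
    induction f using TensorProduct.induction_on with
    | zero => simp
    | tmul u φ => simp; rfl
    | add f g hf hg => rw [map_add, LinearMap.add_apply, hf, hg]
  assoc {A B C D} f g h := by
    induction f using TensorProduct.induction_on with
    | zero => simp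
    | add f f' hf hf' => simp only [map_add, LinearMap.add_apply, hf, hf']
    | tmul u φ =>
      induction g using TensorProduct.induction_on with
      | zero => simp
      | add g g' hg hg' => simp only [map_add, LinearMap.add_apply, hg, hg']
      | tmul v ψ =>
        induction h using TensorProduct.induction_on with
        | zero => simp
        | add h h' hh hh' => simp only [map_add, hh, hh']
        | tmul w χ => simp; rfl

instance (A B : TensObj n) : AddCommGroup (A ⟶ B) :=
  inferInstanceAs (AddCommGroup ((A.X ⟶ B.X) ⊗[F₂] (A.V.carrier →ₗ[F₂] B.V.carrier)))

instance : Preadditive (TensObj n) where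
  homGroup A B := inferInstance
  add_comp A B C f f' g := by
    exact LinearMap.congr_fun (map_add (TensorProduct.map₂ (Linear.comp (S := F₂) A.X B.X C.X)
      (LinearMap.llcomp F₂ A.V.carrier B.V.carrier C.V.carrier).flip) f f') g
  comp_add A B C f g g' := by
    exact map_add (TensorProduct.map₂ (Linear.comp (S := F₂) A.X B.X C.X)
      (LinearMap.llcomp F₂ A.V.carrier B.V.carrier C.V.carrier).flip f) g g'

/-- The morphism `u ⊗ φ`. -/
def tmul {A B : TensObj n} (u : A.X ⟶ B.X) (φ : A.V.carrier →ₗ[F₂] B.V.carrier) : A ⟶ B :=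
  u ⊗ₜ[F₂] φ

/-- The additive enlargement: its objects are finite sums of objects `X ⊗ V`, and its morphisms are
matrices. -/
abbrev BN (n : ℕ) : Type 1 := Mat_ (TensObj n)

/-- The object `C ⊗ W`. -/
def tensorObj (C : BN n) (W : GrVect) : BN n where
  ι := C.ι
  X := fun i => ⟨(C.X i).X, (C.X i).V.tensor W⟩

/-- The morphism `f ⊗ φ` between objects `A ⊗ V` and `B ⊗ W`, for single summands `A` and `B`. -/
def tensorEntry {A B : TensObj n} {V W : GrVect} (φ : V.carrier →ₗ[F₂] W.carrier) (f : A ⟶ B) :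
    (⟨A.X, A.V.tensor V⟩ : TensObj n) ⟶ ⟨B.X, B.V.tensor W⟩ :=
  TensorProduct.map LinearMap.id
    ((TensorProduct.mapBilinear (RingHom.id F₂) A.V.carrier V.carrier B.V.carrier W.carrier).flip φ) f

/-- The morphism `f ⊗ φ` from `C ⊗ V` to `D ⊗ W`. -/
def tensorHom {C D : BN n} {V W : GrVect} (f : C ⟶ D) (φ : V.carrier →ₗ[F₂] W.carrier) :
    tensorObj C V ⟶ tensorObj D W :=
  fun i j => tensorEntry φ (f i j)

/-! ## The ring `RX` and the module `Ξ` -/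

open scoped Polynomial in
/-- The ring `RX = F₂[x] / (x ^ 2)`. -/
abbrev RX : Type := AdjoinRoot (Polynomial.X ^ 2 : F₂[X])

/-- The variable of `RX`. -/
def RX.x : RX := AdjoinRoot.root _

/-- `RX` as a bigraded vector space; `x` has bidegree `(0, -2)`. -/
def grRX : GrVect where
  carrier := RX
  I := Fin (Polynomial.X ^ 2 : Polynomial F₂).natDegree
  basis := (AdjoinRoot.powerBasis' (Polynomial.monic_X_pow (R := F₂) 2)).basis
  deg := fun i => (0, -2 * (i : ℤ))

/-- The subspace `ξ F₂[ξ]` of `F₂[ξ, ξ⁻¹]`. -/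
def posPart : Submodule F₂ (LaurentPolynomial F₂) :=
  Submodule.span F₂ { f | ∃ k : ℤ, 1 ≤ k ∧ f = LaurentPolynomial.T k }

/-- The module `Ξ = F₂[ξ, ξ⁻¹] / ξ F₂[ξ]`. -/
abbrev Xi : Type := LaurentPolynomial F₂ ⧸ posPart

/-- Multiplication by `ξ` on `Ξ`. -/
def mulXi : Xi →ₗ[F₂] Xi :=
  posPart.mapQ posPart (LinearMap.mulLeft F₂ (LaurentPolynomial.T 1)) (by
    rw [posPart, Submodule.span_le]
    rintro _ ⟨k, hk, rfl⟩
    refine Submodule.subset_span ⟨1 + k, by omega, ?_⟩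
    exact (LaurentPolynomial.T_add 1 k).symm)

/-- The coefficients of `1, ξ⁻¹, ξ⁻², …`. -/
def negCoeff : LaurentPolynomial F₂ →ₗ[F₂] (ℕ →₀ F₂) :=
  (Finsupp.lcomapDomain (fun k : ℕ => -(k : ℤ)) (fun _ _ h => by simpa using h)).comp
    (AddMonoidAlgebra.coeffLinearEquiv F₂).toLinearMap

theorem ker_negCoeff : LinearMap.ker negCoeff = posPart := by
  apply le_antisymm
  · intro f hf
    have h0 : ∀ k : ℕ, f.coeff (-(k : ℤ)) = 0 := fun k => DFunLike.congr_fun hf k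
    rw [show f = f.coeff.sum fun k r => r • LaurentPolynomial.T k by
      conv_lhs => rw [← AddMonoidAlgebra.sum_coeff_single f]
      refine Finsupp.sum_congr fun k _ => ?_
      rw [LaurentPolynomial.T, AddMonoidAlgebra.smul_single, smul_eq_mul, mul_one]]
    refine Submodule.sum_mem _ fun k hk => Submodule.smul_mem _ _ (Submodule.subset_span ⟨k, ?_, rfl⟩)
    by_contra hlt
    refine (Finsupp.mem_support_iff.1 hk) ?_
    have := h0 k.natAbs
    rwa [show -(k.natAbs : ℤ) = k by omega] at this
  · rw [posPart, Submodule.span_le]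
    rintro _ ⟨k, hk, rfl⟩
    show negCoeff _ = 0
    ext j
    show (LaurentPolynomial.T k : LaurentPolynomial F₂).coeff (-(j : ℤ)) = 0
    rw [LaurentPolynomial.T, AddMonoidAlgebra.coeff_single, Finsupp.single_apply, if_neg]
    omega

theorem negCoeff_surjective : Function.Surjective negCoeff := by
  intro g
  induction g using Finsupp.induction_linear with
  | zero => exact ⟨0, map_zero _⟩
  | add g g' h h' =>
    obtain ⟨f, rfl⟩ := h
    obtain ⟨f', rfl⟩ := h'
    exact ⟨f + f', map_add _ _ _⟩
  | single k r =>
    refine ⟨AddMonoidAlgebra.single (-(k : ℤ)) r, ?_⟩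
    ext j
    show (AddMonoidAlgebra.single (-(k : ℤ)) r : LaurentPolynomial F₂).coeff (-(j : ℤ)) = _
    rw [AddMonoidAlgebra.coeff_single]
    simp [Finsupp.single_apply]

/-- `Ξ` as a bigraded vector space, with the homogeneous basis `1, ξ⁻¹, ξ⁻², …`; `ξ` has bidegree
`(1, 2)`. -/
def grXi : GrVect where
  carrier := Xi
  I := ℕ
  basis := .ofRepr ((Submodule.quotEquivOfEq _ _ ker_negCoeff.symm).trans
    (LinearMap.quotKerEquivOfSurjective negCoeff negCoeff_surjective))
  deg := fun k => (-(k : ℤ), -2 * (k : ℤ))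

theorem grXi_basis (k : ℕ) :
    grXi.basis k = posPart.mkQ (LaurentPolynomial.T (-(k : ℤ))) := by
  refine (Module.Basis.apply_eq_iff (b := grXi.basis) (i := (k : ℕ))).2 ?_
  show negCoeff (LaurentPolynomial.T (-(k : ℤ))) = _
  ext j
  show (LaurentPolynomial.T (-(k : ℤ)) : LaurentPolynomial F₂).coeff (-(j : ℤ)) = _
  rw [LaurentPolynomial.T, AddMonoidAlgebra.coeff_single]
  simp only [Finsupp.single_apply, neg_inj, Nat.cast_inj]
  exact Finsupp.single_apply.symm

/-! ## Tangle diagrams -/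

/-- A tangle diagram in the disk. Its vertices are the crossings `V`, two-valent vertices `L`
(marked points), and the endpoints on the boundary circle of the disk. Its edges carry a
checkerboard orientation: every edge has a black region on its left and a white one on its right.
So each crossing `v` is the end of the two opposite edges `next.symm (v, false)`,
`next.symm (v, true)`, and the start of the two opposite edges `(v, false)`, `(v, true)`; the
endpoints are alternately starts and ends of edges: their counterclockwise order on the boundary
circle is `+0, -0, +1, -1, …, +(n-1), -(n-1)`. An edge is named by its start, and `next` sends it to
its end.

The two ends at `(v, i)` are adjacent around `v`, and are joined in the `0`-resolution of `v`.
The over strand is the union of the two incoming edges if `overIn v`, and of the two outgoing edges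
otherwise. Hence the counterclockwise order of the ends around `v` is out `(v, false)`,
in `(v, false)`, out `(v, true)`, in `(v, true)` if `overIn v`, and in `(v, false)`,
out `(v, false)`, in `(v, true)`, out `(v, true)` otherwise. -/
structure Diagram (n : ℕ) where
  V : Type
  L : Type
  [fintypeV : Fintype V]
  [decEqV : DecidableEq V]
  [fintypeL : Fintype L]
  [decEqL : DecidableEq L]
  next : ((V × Bool) ⊕ L) ⊕ Fin n ≃ ((V × Bool) ⊕ L) ⊕ Fin n
  overIn : V → Bool

attribute [instance] Diagram.fintypeV Diagram.decEqV Diagram.fintypeL Diagram.decEqL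

namespace Diagram

/-- The edges, named by their starts. -/
abbrev Edge (D : Diagram n) : Type := ((D.V × Bool) ⊕ D.L) ⊕ Fin n

/-- Joining, at each vertex, the incoming end `(v, i)` to the outgoing end `(v, i)` if
`ε v = false`, and to the outgoing end `(v, !i)` if `ε v = true`. -/
def resolve {V L : Type} (n : ℕ) (ε : V → Bool) :
    ((V × Bool) ⊕ L) ⊕ Fin n ≃ ((V × Bool) ⊕ L) ⊕ Fin n :=
  Equiv.sumCongr (Equiv.sumCongr
    { toFun := fun p => (p.1, xor p.2 (ε p.1))
      invFun := fun p => (p.1, xor p.2 (ε p.1))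
      left_inv := fun p => by simp
      right_inv := fun p => by simp } (Equiv.refl L)) (Equiv.refl (Fin n))

/-- The resolution of the diagram at `ε`. -/
def smoothing (D : Diagram n) (ε : D.V → Bool) : Smoothing n where
  X := (D.V × Bool) ⊕ D.L
  next := D.next.trans (resolve n ε)

/-- Going around the boundary circle from the sink `-j` to the source `+(j+1)`. -/
def rotate (n : ℕ) {X : Type} : X ⊕ Fin n ≃ X ⊕ Fin n :=
  Equiv.sumCongr (Equiv.refl X) (finRotate n)

/-- The edge that follows an edge around the region on its left (turn left at each vertex). -/
def leftTurn (D : Diagram n) : Equiv.Perm D.Edge :=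
  (D.next.trans (resolve n fun v => !D.overIn v)).trans (rotate n)

/-- The edge that follows an edge around the region on its right (turn right at each vertex). -/
def rightTurn (D : Diagram n) : Equiv.Perm D.Edge :=
  D.next.trans (resolve n D.overIn)

/-- The number of connected components of the graph, where the boundary circle is collapsed to a
vertex. -/
def numComponents (D : Diagram n) : ℕ :=
  Nat.card (Quot fun e e' : D.Edge => D.leftTurn e = e' ∨ D.rightTurn e = e')

/-- The number of cycles of a permutation. -/
def numCycles {X : Type} (π : Equiv.Perm X) : ℕ := Nat.card (Quot fun e e' : X => π e = e')

/-- The diagram is planar: Euler's formula holds for the graph in the sphere which is obtained by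
collapsing the complement of the open disk to a vertex (if there are endpoints). -/
def Planar (D : Diagram n) : Prop :=
  ((Fintype.card D.V + Fintype.card D.L + (if n = 0 then 0 else 1) : ℕ) : ℤ)
    - Fintype.card D.Edge + numCycles D.leftTurn + numCycles D.rightTurn = 2 * D.numComponents

/-- Two edges are opposite at the crossing `v`, i.e. form a strand through `v`. -/
def Opposite (D : Diagram n) (v : D.V) (e e' : D.Edge) : Prop :=
  ∃ i : Bool, (e = Sum.inl (Sum.inl (v, i)) ∧ e' = Sum.inl (Sum.inl (v, !i))) ∨
    (D.next e = Sum.inl (Sum.inl (v, i)) ∧ D.next e' = Sum.inl (Sum.inl (v, !i)))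

/-- Two edges are equal, or separated by one two-valent vertex only. -/
def Adjacent (D : Diagram n) (e e' : D.Edge) : Prop :=
  e = e' ∨ ∃ l : D.L, (D.next e = Sum.inl (Sum.inr l) ∧ e' = Sum.inl (Sum.inr l)) ∨
    (D.next e' = Sum.inl (Sum.inr l) ∧ e = Sum.inl (Sum.inr l))

/-- The surgery along a band joining the edges `s` and `t` inside a region: the two edges exchange
their ends. -/
def surger (D : Diagram n) (s t : D.Edge) : Diagram n where
  V := D.V
  L := D.L
  next := (Equiv.swap s t).trans D.next
  overIn := D.overIn

end Diagram

/-- The boundary of a tangle: for each endpoint, whether the orientation of the tangle agrees with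
the checkerboard orientation there. -/
structure Ends where
  n : ℕ
  plus : Fin n → Bool
  minus : Fin n → Bool

/-- An orientation of the tangle: for each edge, whether it agrees with the checkerboard
orientation. Strands go straight through the crossings. -/
structure Orientation (E : Ends) (D : Diagram E.n) where
  dir : D.Edge → Bool
  source : ∀ i, dir (Sum.inr i) = E.plus i
  sink : ∀ i, dir (D.next.symm (Sum.inr i)) = E.minus i
  mark : ∀ l, dir (D.next.symm (Sum.inl (Sum.inr l))) = dir (Sum.inl (Sum.inr l))
  strandIn : ∀ v, dir (D.next.symm (Sum.inl (Sum.inl (v, true)))) =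
    !dir (D.next.symm (Sum.inl (Sum.inl (v, false))))
  strandOut : ∀ v, dir (Sum.inl (Sum.inl (v, true))) = !dir (Sum.inl (Sum.inl (v, false)))

/-- An oriented tangle diagram with endpoints `E`. -/
structure Tangle (E : Ends) where
  diagram : Diagram E.n
  orientation : Orientation E diagram

namespace Tangle

variable {E : Ends}

/-- The edges of a tangle; they are used as the possible positions of basepoints. -/
abbrev Edge (T : Tangle E) : Type := T.diagram.Edge

abbrev V (T : Tangle E) : Type := T.diagram.V

/-- The sign of a crossing: it is positive if its oriented resolution is its `0`-resolution. -/
def positive (T : Tangle E) (v : T.V) : Bool :=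
  T.orientation.dir (T.diagram.next.symm (Sum.inl (Sum.inl (v, false)))) ==
    T.orientation.dir (Sum.inl (Sum.inl (v, false)))

/-- The bidegree `(|ε| - n₋, |ε| + n₊ - 2 n₋)` of the `ε`-resolution. -/
def bideg (T : Tangle E) (ε : T.V → Bool) : ℤ × ℤ :=
  let w : ℤ := (Finset.univ.filter fun v => ε v = true).card
  let np : ℤ := (Finset.univ.filter fun v => T.positive v = true).card
  let nm : ℤ := (Finset.univ.filter fun v => T.positive v = false).card
  (w - nm, w + np - 2 * nm)

/-- The object of Bar-Natan's complex of a tangle: the sum of all its resolutions. -/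
def CBN (T : Tangle E) : BN E.n where
  ι := T.V → Bool
  X := fun ε => ⟨toLoc (T.diagram.smoothing ε), GrVect.line (T.bideg ε)⟩

/-- A dotted cobordism between resolutions, as a morphism between summands. -/
def entry {T T' : Tangle E} {ε : T.V → Bool} {ε' : T'.V → Bool}
    (f : T.diagram.smoothing ε ⟶ T'.diagram.smoothing ε') : T.CBN.X ε ⟶ T'.CBN.X ε' :=
  tmul (cls f) (LinearMap.id : F₂ →ₗ[F₂] F₂)

end Tangle

theorem isSurgery_flip {V L : Type} [Fintype V] [DecidableEq V]
    (f : ((V × Bool) ⊕ L) ⊕ Fin n ≃ ((V × Bool) ⊕ L) ⊕ Fin n) (v : V) {ε ε' : V → Bool}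
    (h : ε' v = !ε v) (h' : ∀ w, w ≠ v → ε' w = ε w) :
    IsSurgery (f.trans (Diagram.resolve n ε)) (f.trans (Diagram.resolve n ε'))
      (f.symm (Sum.inl (Sum.inl (v, false)))) (f.symm (Sum.inl (Sum.inl (v, true)))) where
  ne := by simp
  left := by simp [Diagram.resolve, h]
  right := by simp [Diagram.resolve, h]
  other := by
    intro u hs ht
    rw [ne_eq, Equiv.eq_symm_apply] at hs ht
    show Diagram.resolve n ε' (f u) = Diagram.resolve n ε (f u)
    rcases hu : f u with (⟨w, i⟩ | l) | j
    · have hw : w ≠ v := by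
        rintro rfl
        cases i
        · exact hs hu
        · exact ht hu
      simp [Diagram.resolve, h' w hw]
    · rfl
    · rfl

theorem isSurgery_swap {X : Type} [DecidableEq X] (f r r' : X ⊕ Fin n ≃ X ⊕ Fin n)
    {s t : X ⊕ Fin n} (hst : s ≠ t) (hr : r' = r) :
    IsSurgery (f.trans r) (((Equiv.swap s t).trans f).trans r') s t where
  ne := hst
  left := by simp [hr]
  right := by simp [hr]
  other := by
    intro u hs ht
    simp [hr, Equiv.swap_apply_of_ne_of_ne hs ht]

namespace Diagram

/-- The saddle cobordism between two resolutions that differ exactly at the crossing `v`. -/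
def flip (D : Diagram n) (v : D.V) {ε ε' : D.V → Bool} (h : ε' v = !ε v)
    (h' : ∀ w, w ≠ v → ε' w = ε w) : D.smoothing ε ⟶ D.smoothing ε' :=
  Cob.saddle _ _ _ _ (isSurgery_flip D.next v h h')

/-- The saddle cobordism of a surgery of the diagram, at a resolution. -/
def saddle (D : Diagram n) {s t : D.Edge} (hst : s ≠ t) {ε ε' : D.V → Bool} (h : ε = ε') :
    D.smoothing ε ⟶ (D.surger s t).smoothing ε' :=
  Cob.saddle _ _ _ _
    (isSurgery_swap D.next (resolve n ε) (resolve n ε') hst (congrArg (resolve n) h.symm))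

end Diagram

namespace Tangle

variable {E : Ends}

/-- The differential of Bar-Natan's complex: the sum of the saddles that change one `0`-resolution
to a `1`-resolution. -/
def d (T : Tangle E) : T.CBN ⟶ T.CBN := fun (ε ε' : T.V → Bool) =>
  ∑ v : T.V, if h : (ε' v = !ε v ∧ ∀ w, w ≠ v → ε' w = ε w) ∧ ε v = false
    then entry (T.diagram.flip v h.1.1 h.1.2) else 0

/-- The basepoint sliding homotopy `H_v`: the sum of the saddles that change the `1`-resolution of
`v` to the `0`-resolution. -/
def slideHomotopy (T : Tangle E) (v : T.V) : T.CBN ⟶ T.CBN := fun (ε ε' : T.V → Bool) =>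
  if h : (ε' v = !ε v ∧ ∀ w, w ≠ v → ε' w = ε w) ∧ ε v = true
    then entry (T.diagram.flip v h.1.1 h.1.2) else 0

/-- The basepoint action: the identity cobordism of each resolution with one dot. -/
def basepoint (T : Tangle E) (p : T.Edge) : T.CBN ⟶ T.CBN := fun (ε ε' : T.V → Bool) =>
  if h : ε = ε' then
    entry (Cob.dot (T.diagram.smoothing ε) ((T.diagram.smoothing ε).comp p)) ≫
      eqToHom (congrArg T.CBN.X h)
  else 0

end Tangle

/-! ## Adding a kink -/

namespace Diagram

/-- The vertices and ends of edges of a diagram with one more crossing `none` and one more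
two-valent vertex `none` are the old ones (`Sum.inl`), the two at the new crossing
(`Sum.inr (some i)`), and the one at the new two-valent vertex (`Sum.inr none`). -/
def split (V L : Type) (n : ℕ) : ((Option V × Bool) ⊕ Option L) ⊕ Fin n ≃
    (((V × Bool) ⊕ L) ⊕ Fin n) ⊕ Option Bool where
  toFun
    | Sum.inl (Sum.inl (none, i)) => Sum.inr (some i)
    | Sum.inl (Sum.inr none) => Sum.inr none
    | Sum.inl (Sum.inl (some v, i)) => Sum.inl (Sum.inl (Sum.inl (v, i)))
    | Sum.inl (Sum.inr (some l)) => Sum.inl (Sum.inl (Sum.inr l))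
    | Sum.inr j => Sum.inl (Sum.inr j)
  invFun
    | Sum.inr (some i) => Sum.inl (Sum.inl (none, i))
    | Sum.inr none => Sum.inl (Sum.inr none)
    | Sum.inl (Sum.inl (Sum.inl (v, i))) => Sum.inl (Sum.inl (some v, i))
    | Sum.inl (Sum.inl (Sum.inr l)) => Sum.inl (Sum.inr (some l))
    | Sum.inl (Sum.inr j) => Sum.inr j
  left_inv := by rintro (((⟨_ | v, i⟩) | (_ | l)) | j) <;> rfl
  right_inv := by rintro ((((⟨v, i⟩) | l) | j) | (_ | i)) <;> rfl

/-- The edge `s` of `f`, from its start `A` to its end `B`, becomes a kink: the new edges are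
`s` from `A` to `some false`, then `some false` to `none`, `none` to `some true`, and
`some true` to `B`. -/
def kinkEquiv {X : Type} [DecidableEq X] (f : X ≃ X) (s : X) :
    X ⊕ Option Bool ≃ X ⊕ Option Bool where
  toFun
    | Sum.inl e => if e = s then Sum.inr (some false) else Sum.inl (f e)
    | Sum.inr (some false) => Sum.inr none
    | Sum.inr none => Sum.inr (some true)
    | Sum.inr (some true) => Sum.inl (f s)
  invFun
    | Sum.inl x => if x = f s then Sum.inr (some true) else Sum.inl (f.symm x)
    | Sum.inr (some false) => Sum.inl s
    | Sum.inr none => Sum.inr (some false)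
    | Sum.inr (some true) => Sum.inr none
  left_inv := by
    rintro (e | (_ | (_ | _)))
    · by_cases h : e = s <;> simp [h]
    all_goals simp
  right_inv := by
    rintro (e | (_ | (_ | _)))
    · by_cases h : e = f s
      · simp [h]
      · have h' : f.symm e ≠ s := fun h' => h (by simp [← h'])
        simp [h, h']
    all_goals simp

/-- The diagram with a kink inserted into the edge `s`. The new crossing is `none`; the edge `s` now
ends at `(none, false)`, the edge `(none, false)` runs to the new two-valent vertex, the edge
starting there runs to `(none, true)`, and the edge `(none, true)` runs to the former end of `s`.
The two values of `ov` give the kinks with loops on the two sides of `s`. -/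
def kink (D : Diagram n) (s : D.Edge) (ov : Bool) : Diagram n where
  V := Option D.V
  L := Option D.L
  next := ((split D.V D.L n).trans (kinkEquiv D.next s)).trans (split D.V D.L n).symm
  overIn
    | none => ov
    | some v => D.overIn v

/-- An edge of a diagram, as an edge of the diagram with a kink. -/
def embed (D : Diagram n) (s : D.Edge) (ov : Bool) (e : D.Edge) : (D.kink s ov).Edge :=
  (split D.V D.L n).symm (Sum.inl e)

/-- The edge that starts at `(none, i)` at the new crossing. -/
def out (D : Diagram n) (s : D.Edge) (ov : Bool) (i : Bool) : (D.kink s ov).Edge :=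
  (split D.V D.L n).symm (Sum.inr (some i))

/-- The edge that starts at the new two-valent vertex, in the loop of the kink. -/
def loop (D : Diagram n) (s : D.Edge) (ov : Bool) : (D.kink s ov).Edge :=
  (split D.V D.L n).symm (Sum.inr none)

end Diagram

variable {E : Ends}

/-- Extends an orientation to a diagram with a kink, by the values `b i` on the edges `(none, i)` and
`c` on the edge starting at the new two-valent vertex. The function `g` sends every end of an edge
to the corresponding start. -/
def Orientation.extend {D : Diagram E.n} (o : Orientation E D) (b : Bool → Bool) (c : Bool)
    (f : ((Option D.V × Bool) ⊕ Option D.L) ⊕ Fin E.n ≃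
      ((Option D.V × Bool) ⊕ Option D.L) ⊕ Fin E.n) (w : Option D.V → Bool)
    (g : D.Edge ⊕ Option Bool → D.Edge ⊕ Option Bool)
    (hg : ∀ y, f.symm ((Diagram.split D.V D.L E.n).symm y) =
      (Diagram.split D.V D.L E.n).symm (g y))
    (hold : ∀ x, Sum.elim o.dir (fun a => a.elim c b) (g (Sum.inl x)) = o.dir (D.next.symm x))
    (hmark : Sum.elim o.dir (fun a => a.elim c b) (g (Sum.inr none)) = c)
    (hin : Sum.elim o.dir (fun a => a.elim c b) (g (Sum.inr (some true))) =
      !Sum.elim o.dir (fun a => a.elim c b) (g (Sum.inr (some false))))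
    (hout : b true = !b false) :
    Orientation E { V := Option D.V, L := Option D.L, next := f, overIn := w } where
  dir e := Sum.elim o.dir (fun a => a.elim c b) (Diagram.split D.V D.L E.n e)
  source i := o.source i
  sink i := by
    have h := hg (Sum.inl (Sum.inr i))
    change f.symm (Sum.inr i) = _ at h
    rw [h, Equiv.apply_symm_apply, hold]
    exact o.sink i
  mark l := by
    rcases l with _ | l
    · have h := hg (Sum.inr none)
      change f.symm (Sum.inl (Sum.inr none)) = _ at h
      rw [h, Equiv.apply_symm_apply, hmark]
      rfl
    · have h := hg (Sum.inl (Sum.inl (Sum.inr l)))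
      change f.symm (Sum.inl (Sum.inr (some l))) = _ at h
      rw [h, Equiv.apply_symm_apply, hold]
      exact o.mark l
  strandIn v := by
    rcases v with _ | v
    · have h := fun i => hg (Sum.inr (some i))
      change ∀ i, f.symm (Sum.inl (Sum.inl (none, i))) = _ at h
      rw [h, h, Equiv.apply_symm_apply, Equiv.apply_symm_apply, hin]
    · have h := fun i => hg (Sum.inl (Sum.inl (Sum.inl (v, i))))
      change ∀ i, f.symm (Sum.inl (Sum.inl (some v, i))) = _ at h
      rw [h, h, Equiv.apply_symm_apply, Equiv.apply_symm_apply, hold, hold]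
      exact o.strandIn v
  strandOut v := by
    rcases v with _ | v
    · exact hout
    · exact o.strandOut v

theorem swap_trans_symm {X Y : Type} [DecidableEq X] [DecidableEq Y] (σ : X ≃ Y) (k : Y ≃ Y)
    (a b y : Y) : ((Equiv.swap (σ.symm a) (σ.symm b)).trans ((σ.trans k).trans σ.symm)).symm
      (σ.symm y) = σ.symm (Equiv.swap a b (k.symm y)) := by
  simp only [Equiv.symm_trans_apply, Equiv.symm_swap, Equiv.symm_symm, Equiv.apply_symm_apply]
  simp only [Equiv.swap_apply_def, EmbeddingLike.apply_eq_iff_eq]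
  split_ifs <;> rfl

namespace Tangle

/-- A tangle with a negative kink on the edge `s`. -/
def negKink (T : Tangle E) (s : T.Edge) (ov : Bool) : Tangle E where
  diagram := T.diagram.kink s ov
  orientation := T.orientation.extend (fun i => T.orientation.dir s == i) (!T.orientation.dir s)
    _ _ (Diagram.kinkEquiv T.diagram.next s).symm
    (fun y => by simp)
    (fun x => by by_cases h : x = T.diagram.next s <;> simp [Diagram.kinkEquiv, h])
    (by simp [Diagram.kinkEquiv])
    (by simp [Diagram.kinkEquiv])
    (by simp)

/-- A tangle with a positive kink on the edge `s`. It is obtained from the negative kink by a surgery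
along a band joining the edge at which the kink is left to the first edge of its loop. -/
def posKinkOut (T : Tangle E) (s : T.Edge) (ov : Bool) : Tangle E where
  diagram := (T.diagram.kink s ov).surger (T.diagram.out s ov false) (T.diagram.out s ov true)
  orientation := T.orientation.extend (fun i => T.orientation.dir s == !i) (!T.orientation.dir s)
    _ _ (fun y => Equiv.swap (Sum.inr (some false)) (Sum.inr (some true))
      ((Diagram.kinkEquiv T.diagram.next s).symm y))
    (swap_trans_symm _ _ _ _)
    (fun x => by
      by_cases h : x = T.diagram.next s <;> simp [Diagram.kinkEquiv, Equiv.swap_apply_def, h])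
    (by simp [Diagram.kinkEquiv])
    (by simp [Diagram.kinkEquiv, Equiv.swap_apply_def])
    (by simp)

/-- A tangle with a positive kink on the edge `s`. It is obtained from the negative kink by a surgery
along a band joining the edge at which the kink is entered to the first edge of its loop. -/
def posKinkIn (T : Tangle E) (s : T.Edge) (ov : Bool) : Tangle E where
  diagram := (T.diagram.kink s ov).surger (T.diagram.embed s ov s) (T.diagram.out s ov false)
  orientation := T.orientation.extend (fun i => T.orientation.dir s == i) (T.orientation.dir s)
    _ _ (fun y => Equiv.swap (Sum.inl s) (Sum.inr (some false))
      ((Diagram.kinkEquiv T.diagram.next s).symm y))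
    (swap_trans_symm _ _ _ _)
    (fun x => by
      by_cases h : x = T.diagram.next s
      · simp [Diagram.kinkEquiv, Equiv.swap_apply_def, h]
      · have h' : T.diagram.next.symm x ≠ s := fun h' => h (by simp [← h'])
        simp [Diagram.kinkEquiv, Equiv.swap_apply_def, h, h'])
    (by simp [Diagram.kinkEquiv])
    (by simp [Diagram.kinkEquiv, Equiv.swap_apply_def])
    (by simp)

theorem negKink_negative (T : Tangle E) (s : T.Edge) (ov : Bool) :
    (T.negKink s ov).positive none = false := by
  have h : (T.diagram.kink s ov).next.symm (Sum.inl (Sum.inl (none, false))) =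
      T.diagram.embed s ov s := rfl
  show (_ == _) = false
  change ((T.negKink s ov).orientation.dir ((T.diagram.kink s ov).next.symm
    (Sum.inl (Sum.inl (none, false)))) == _) = false
  rw [h]
  show (Sum.elim _ _ (Diagram.split _ _ _ ((Diagram.split _ _ _).symm _)) ==
    (T.orientation.dir s == false)) = false
  rw [Equiv.apply_symm_apply]
  cases h2 : T.orientation.dir s <;> simp [h2]

theorem posKinkOut_positive (T : Tangle E) (s : T.Edge) (ov : Bool) :
    (T.posKinkOut s ov).positive none = true := by
  have h : ((T.diagram.kink s ov).surger (T.diagram.out s ov false)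
      (T.diagram.out s ov true)).next.symm (Sum.inl (Sum.inl (none, false))) =
      T.diagram.embed s ov s :=
    swap_trans_symm _ _ (Sum.inr (some false)) (Sum.inr (some true)) (Sum.inr (some false))
  change ((T.posKinkOut s ov).orientation.dir (((T.diagram.kink s ov).surger
    (T.diagram.out s ov false) (T.diagram.out s ov true)).next.symm
    (Sum.inl (Sum.inl (none, false)))) == _) = true
  rw [h]
  show (Sum.elim _ _ (Diagram.split _ _ _ ((Diagram.split _ _ _).symm _)) ==
    (T.orientation.dir s == true)) = true
  rw [Equiv.apply_symm_apply]
  cases h2 : T.orientation.dir s <;> simp [h2]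

theorem posKinkIn_positive (T : Tangle E) (s : T.Edge) (ov : Bool) :
    (T.posKinkIn s ov).positive none = true := by
  have h : ((T.diagram.kink s ov).surger (T.diagram.embed s ov s)
      (T.diagram.out s ov false)).next.symm (Sum.inl (Sum.inl (none, false))) =
      T.diagram.out s ov false :=
    (swap_trans_symm _ _ (Sum.inl s) (Sum.inr (some false)) (Sum.inr (some false))).trans
      (by simp [Diagram.kinkEquiv]; rfl)
  change ((T.posKinkIn s ov).orientation.dir (((T.diagram.kink s ov).surger
    (T.diagram.embed s ov s) (T.diagram.out s ov false)).next.symm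
    (Sum.inl (Sum.inl (none, false)))) == _) = true
  rw [h]
  show ((T.orientation.dir s == false) == (T.orientation.dir s == false)) = true
  simp

end Tangle

namespace Smoothing

theorem comp_eq (a : Smoothing n) {e : a.Seg} {x : a.X} (h : a.next e = Sum.inl x) :
    a.comp e = a.comp (Sum.inl x) :=
  Quot.sound ⟨x, h, rfl⟩

/-- The components of a disjoint union with a circle, described by a function on the old segments
and its value on the circle. -/
def addCircleLift (a : Smoothing n) {S : Type} (u : a.Seg → S) (c : S)
    (hu : ∀ e x, a.next e = Sum.inl x → u e = u (Sum.inl x)) : a.addCircle.Comp → S :=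
  Quot.lift
    (fun
      | Sum.inl none => c
      | Sum.inl (some x) => u (Sum.inl x)
      | Sum.inr i => u (Sum.inr i))
    (by
      rintro ((_ | x) | i) _ ⟨y, hy, rfl⟩
      · obtain rfl : none = y := Sum.inl_injective hy
        rfl
      · change (a.next (Sum.inl x)).map some _root_.id = _ at hy
        rcases hx : a.next (Sum.inl x) with z | j <;> rw [hx] at hy
        · obtain rfl : some z = y := Sum.inl_injective hy
          exact hu _ _ hx
        · cases hy
      · change (a.next (Sum.inr i)).map some _root_.id = _ at hy
        rcases hx : a.next (Sum.inr i) with z | j <;> rw [hx] at hy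
        · obtain rfl : some z = y := Sum.inl_injective hy
          exact hu _ _ hx
        · cases hy)

theorem addCircleLift_toAddCircle (a : Smoothing n) {S : Type} (u : a.Seg → S) (c : S)
    (hu : ∀ e x, a.next e = Sum.inl x → u e = u (Sum.inl x)) (e : a.Seg) :
    a.addCircleLift u c hu (a.toAddCircle (a.comp e)) = u e := by
  rcases e with x | i <;> rfl

theorem addCircle_cases (a : Smoothing n) (p : a.addCircle.Comp) :
    p = a.newCircle ∨ ∃ e, p = a.toAddCircle (a.comp e) := by
  induction p using Quot.ind with | _ p =>
  rcases p with (_ | x) | i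
  · exact Or.inl rfl
  · exact Or.inr ⟨Sum.inl x, rfl⟩
  · exact Or.inr ⟨Sum.inr i, rfl⟩

end Smoothing

namespace Diagram

theorem split_symm_inr_inl {V L : Type} (i : Fin n) :
    (split V L n).symm (Sum.inl (Sum.inr i)) = Sum.inr i := rfl

/-- The combinatorics of a resolution of a diagram with a kink on the edge `s`, in which the kink
splits off a circle. In the coordinates `split`, the segments of the resolution are given by `N`;
`onCircle` tells which of the new segments are on the circle, and the remaining ones form, together
with `s`, a subdivision of `s`. -/
structure SplitsCircle {V L : Type} [Fintype V] [DecidableEq V] [Fintype L] [DecidableEq L]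
    (f : ((V × Bool) ⊕ L) ⊕ Fin n ≃ ((V × Bool) ⊕ L) ⊕ Fin n)
    (g : ((Option V × Bool) ⊕ Option L) ⊕ Fin n ≃ ((Option V × Bool) ⊕ Option L) ⊕ Fin n)
    (s : ((V × Bool) ⊕ L) ⊕ Fin n) (c : Option Bool) (onCircle : Option Bool → Bool)
    (N : (((V × Bool) ⊕ L) ⊕ Fin n) ⊕ Option Bool → (((V × Bool) ⊕ L) ⊕ Fin n) ⊕ Option Bool) :
    Prop where
  next : ∀ y, g ((split V L n).symm y) = (split V L n).symm (N y)
  old : ∀ e, e ≠ s → N (Sum.inl e) = Sum.inl (f e)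
  circle : ∀ o, onCircle o = true → ∃ o', N (Sum.inr o) = Sum.inr o' ∧ onCircle o' = true
  first : ∃ o, N (Sum.inl s) = Sum.inr o ∧ onCircle o = false
  middle : ∀ o, onCircle o = false → N (Sum.inr o) = Sum.inl (f s) ∨
    ∃ o', N (Sum.inr o) = Sum.inr o' ∧ onCircle o' = false
  last : ∃ o, onCircle o = false ∧ N (Sum.inr o) = Sum.inl (f s)
  onCircle_c : onCircle c = true
  connected : ∀ o, (Smoothing.mk _ g).comp ((split V L n).symm (Sum.inr o)) =
    (Smoothing.mk _ g).comp ((split V L n).symm (bif onCircle o then Sum.inr c else Sum.inl s))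

namespace SplitsCircle

variable {V L : Type} [Fintype V] [DecidableEq V] [Fintype L] [DecidableEq L]
  {f : ((V × Bool) ⊕ L) ⊕ Fin n ≃ ((V × Bool) ⊕ L) ⊕ Fin n}
  {g : ((Option V × Bool) ⊕ Option L) ⊕ Fin n ≃ ((Option V × Bool) ⊕ Option L) ⊕ Fin n}
  {s : ((V × Bool) ⊕ L) ⊕ Fin n} {c : Option Bool} {onCircle : Option Bool → Bool}
  {N : (((V × Bool) ⊕ L) ⊕ Fin n) ⊕ Option Bool → (((V × Bool) ⊕ L) ⊕ Fin n) ⊕ Option Bool}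

theorem comp_next (h : SplitsCircle f g s c onCircle N)
    {y z : (((V × Bool) ⊕ L) ⊕ Fin n) ⊕ Option Bool} (hy : N y = z) {x}
    (hz : (split V L n).symm z = Sum.inl x) :
    (Smoothing.mk _ g).comp ((split V L n).symm y) =
      (Smoothing.mk _ g).comp ((split V L n).symm z) := by
  rw [hz]
  exact Smoothing.comp_eq _ (by rw [← hz, ← hy]; exact h.next y)

theorem comp_old (h : SplitsCircle f g s c onCircle N) (e : ((V × Bool) ⊕ L) ⊕ Fin n)
    (x : (V × Bool) ⊕ L) (hx : f e = Sum.inl x) :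
    (Smoothing.mk _ g).comp ((split V L n).symm (Sum.inl e)) =
      (Smoothing.mk _ g).comp ((split V L n).symm (Sum.inl (Sum.inl x))) := by
  have key : ∃ x', (split V L n).symm (Sum.inl (Sum.inl x)) = Sum.inl x' := by
    rcases x with ⟨v, i⟩ | l <;> exact ⟨_, rfl⟩
  obtain ⟨x', hx'⟩ := key
  by_cases he : e = s
  · subst he
    obtain ⟨o, ho, hN⟩ := h.last
    have h1 := h.connected o
    rw [ho, cond_false] at h1
    rw [← h1]
    exact h.comp_next (hN.trans (by rw [hx])) hx'
  · exact h.comp_next ((h.old e he).trans (by rw [hx])) hx'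

/-- The components of the resolution of the diagram with the kink: the circle of the kink, and the
components of the resolution of the diagram without the kink. -/
def comps (h : SplitsCircle f g s c onCircle N) :
    (Smoothing.addCircle ⟨_, f⟩).Comp ≃ (Smoothing.mk _ g).Comp where
  toFun := Smoothing.addCircleLift ⟨_, f⟩
    (fun e => (Smoothing.mk _ g).comp ((split V L n).symm (Sum.inl e)))
    ((Smoothing.mk _ g).comp ((split V L n).symm (Sum.inr c))) h.comp_old
  invFun := Quot.lift
    (fun e => Sum.elim
      (fun e => Smoothing.toAddCircle ⟨_, f⟩ (Smoothing.comp ⟨_, f⟩ e))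
      (fun o => bif onCircle o then Smoothing.newCircle ⟨_, f⟩ else
        Smoothing.toAddCircle ⟨_, f⟩ (Smoothing.comp ⟨_, f⟩ s)) (split V L n e))
    (by
      rintro e _ ⟨x, hx, rfl⟩
      obtain ⟨y, rfl⟩ := (split V L n).symm.surjective e
      change g _ = _ at hx
      rw [h.next] at hx
      rw [← hx, Equiv.apply_symm_apply, Equiv.apply_symm_apply]
      have key : ∀ e, N y = Sum.inl (f e) →
          Smoothing.toAddCircle ⟨_, f⟩ (Smoothing.comp ⟨_, f⟩ (f e)) =
            Smoothing.toAddCircle ⟨_, f⟩ (Smoothing.comp ⟨_, f⟩ e) := by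
        intro e he
        rw [he] at hx
        rcases hf : f e with z | i
        · exact congrArg _ (Smoothing.comp_eq ⟨_, f⟩ hf).symm
        · rw [hf] at hx
          cases hx
      rcases y with e | o
      · by_cases he : e = s
        · subst he
          obtain ⟨o, ho, ho'⟩ := h.first
          simp [ho, ho']
        · rw [h.old e he]
          exact (key e (h.old e he)).symm
      · cases ho : onCircle o
        · rcases h.middle o ho with h' | ⟨o', h', ho'⟩
          · rw [h']
            simpa [ho] using (key s h').symm
          · simp [h', ho, ho']
        · obtain ⟨o', h', ho'⟩ := h.circle o ho
          simp [h', ho, ho'])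
  left_inv p := by
    rcases Smoothing.addCircle_cases _ p with rfl | ⟨e, rfl⟩
    · show Sum.elim _ _ (split V L n ((split V L n).symm (Sum.inr c))) = _
      simp [h.onCircle_c]
    · rw [Smoothing.addCircleLift_toAddCircle]
      show Sum.elim _ _ (split V L n ((split V L n).symm (Sum.inl e))) = _
      simp
  right_inv p := by
    induction p using Quot.ind with | _ e =>
    obtain ⟨y, rfl⟩ := (split V L n).symm.surjective e
    show Smoothing.addCircleLift _ _ _ _ (Sum.elim _ _ (split V L n ((split V L n).symm y))) = _
    rw [Equiv.apply_symm_apply]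
    rcases y with e | o
    · exact Smoothing.addCircleLift_toAddCircle ⟨_, f⟩ _ _ h.comp_old e
    · have h1 := h.connected o
      cases ho : onCircle o
      · rw [ho] at h1
        rw [Sum.elim_inr, ho, cond_false, Smoothing.addCircleLift_toAddCircle]
        exact h1.symm
      · rw [ho] at h1
        rw [Sum.elim_inr, ho]
        exact h1.symm

theorem comps_source (h : SplitsCircle f g s c onCircle N) (i : Fin n) :
    h.comps (Smoothing.comp _ (Sum.inr i)) = Smoothing.comp _ (Sum.inr i) := rfl

theorem comps_sink (h : SplitsCircle f g s c onCircle N) (i : Fin n) :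
    h.comps (Smoothing.comp _ ((Smoothing.addCircle ⟨_, f⟩).next.symm (Sum.inr i))) =
      Smoothing.comp _ (g.symm (Sum.inr i)) := by
  have h0 : Smoothing.comp _ ((Smoothing.addCircle ⟨_, f⟩).next.symm (Sum.inr i)) =
      Smoothing.toAddCircle ⟨_, f⟩ (Smoothing.comp ⟨_, f⟩ (f.symm (Sum.inr i))) := rfl
  rw [h0]
  refine (Smoothing.addCircleLift_toAddCircle ⟨_, f⟩ _ _ h.comp_old _).trans ?_
  have key : ∀ y, N y = Sum.inl (Sum.inr i) → g.symm (Sum.inr i) = (split V L n).symm y := by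
    intro y hy
    rw [Equiv.symm_apply_eq, h.next, hy]
    rfl
  by_cases he : f.symm (Sum.inr i) = s
  · obtain ⟨o, ho, hN⟩ := h.last
    have h1 := h.connected o
    rw [ho, cond_false] at h1
    rw [he, ← h1, key (Sum.inr o) (by rw [hN, ← he]; simp)]
  · rw [key _ ((h.old _ he).trans (by simp))]

/-- The cylinder of the planar isotopy that contracts the arcs of the kink. -/
def cylinder (h : SplitsCircle f g s c onCircle N) :
    Smoothing.addCircle ⟨_, f⟩ ⟶ Smoothing.mk _ g :=
  Cob.cylinder _ _ h.comps h.comps_source h.comps_sink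

/-- The inverse of `cylinder`. -/
def cylinderInv (h : SplitsCircle f g s c onCircle N) :
    Smoothing.mk _ g ⟶ Smoothing.addCircle ⟨_, f⟩ :=
  Cob.cylinder _ _ h.comps.symm (fun i => by rw [Equiv.symm_apply_eq, h.comps_source])
    (fun i => (Equiv.symm_apply_eq _).2 (h.comps_sink i).symm)

end SplitsCircle

end Diagram

namespace Diagram

theorem resolve_split {V L : Type} {ε : V → Bool} {ε' : Option V → Bool}
    (h : ∀ v, ε' (some v) = ε v) (y : (((V × Bool) ⊕ L) ⊕ Fin n) ⊕ Option Bool) :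
    resolve n ε' ((split V L n).symm y) =
      (split V L n).symm (y.map (resolve n ε) (Option.map fun i => xor i (ε' none))) := by
  rcases y with (((⟨v, i⟩ | l) | j) | (_ | i))
  · show Sum.inl (Sum.inl (some v, xor i (ε' (some v)))) = _
    rw [h]
    rfl
  all_goals rfl

variable (D : Diagram n) (s : D.Edge) (ov : Bool)

/-- In the `1`-resolution of a negative kink, the edges `out false` and `loop` form a circle. -/
theorem splits_negKink {ε : D.V → Bool} {ε' : Option D.V → Bool} (h : ∀ v, ε' (some v) = ε v)
    (h' : ε' none = true) :
    SplitsCircle (D.next.trans (resolve n ε)) ((D.kink s ov).next.trans (resolve n ε')) s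
      (some false) (fun o => o != some true)
      (fun y => (kinkEquiv D.next s y).map (resolve n ε) (Option.map fun i => !i)) := by
  have hnext : ∀ y, ((D.kink s ov).next.trans (resolve n ε')) ((split D.V D.L n).symm y) =
      (split D.V D.L n).symm
        ((kinkEquiv D.next s y).map (resolve n ε) (Option.map fun i => !i)) := by
    intro y
    show resolve n ε' ((split D.V D.L n).symm (kinkEquiv D.next s _)) = _
    rw [resolve_split h, h', Equiv.apply_symm_apply]
    simp
  refine ⟨hnext, fun e he => by simp [kinkEquiv, he], ?_, ⟨some true, by simp [kinkEquiv]⟩, ?_,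
    ⟨some true, by simp [kinkEquiv]⟩, rfl, ?_⟩
  · rintro (_ | (_ | _)) ho
    · exact ⟨some false, by simp [kinkEquiv]⟩
    · exact ⟨none, by simp [kinkEquiv]⟩
    · simp at ho
  · rintro (_ | (_ | _)) ho
    · simp at ho
    · simp at ho
    · exact Or.inl (by simp [kinkEquiv])
  · rintro (_ | (_ | _))
    · exact Smoothing.comp_eq _ ((hnext (Sum.inr none)).trans (by simp [kinkEquiv]; rfl))
    · rfl
    · exact (Smoothing.comp_eq _ ((hnext (Sum.inl s)).trans (by simp [kinkEquiv]; rfl))).symm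

theorem surger_split {ε : D.V → Bool} {ε' : Option D.V → Bool} (h : ∀ v, ε' (some v) = ε v)
    (h' : ε' none = false) (a b y : D.Edge ⊕ Option Bool) :
    (((D.kink s ov).surger ((split D.V D.L n).symm a) ((split D.V D.L n).symm b)).next.trans
      (resolve n ε')) ((split D.V D.L n).symm y) = (split D.V D.L n).symm
        ((kinkEquiv D.next s (Equiv.swap a b y)).map (resolve n ε) fun o => o) := by
  have h1 : (Equiv.swap ((split D.V D.L n).symm a) ((split D.V D.L n).symm b))
      ((split D.V D.L n).symm y) = (split D.V D.L n).symm (Equiv.swap a b y) := by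
    simp only [Equiv.swap_apply_def, EmbeddingLike.apply_eq_iff_eq]
    split_ifs <;> rfl
  show resolve n ε' ((split D.V D.L n).symm (kinkEquiv D.next s (split D.V D.L n
    (Equiv.swap ((split D.V D.L n).symm a) ((split D.V D.L n).symm b)
      ((split D.V D.L n).symm y))))) = _
  rw [resolve_split h, h', h1, Equiv.apply_symm_apply]
  congr 2
  funext o
  rcases o with _ | i <;> simp

/-- In the `0`-resolution of the positive kink `posKinkOut`, the edges `out true` and `loop` form a
circle. -/
theorem splits_posKinkOut {ε : D.V → Bool} {ε' : Option D.V → Bool}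
    (h : ∀ v, ε' (some v) = ε v) (h' : ε' none = false) :
    SplitsCircle (D.next.trans (resolve n ε))
      (((D.kink s ov).surger (D.out s ov false) (D.out s ov true)).next.trans (resolve n ε')) s
      (some true) (fun o => o != some false)
      (fun y => (kinkEquiv D.next s (Equiv.swap (Sum.inr (some false)) (Sum.inr (some true)) y)).map
        (resolve n ε) fun o => o) := by
  have hnext := D.surger_split s ov h h' (Sum.inr (some false)) (Sum.inr (some true))
  refine ⟨hnext, fun e he => by simp [kinkEquiv, Equiv.swap_apply_def, he], ?_,
    ⟨some false, by simp [kinkEquiv, Equiv.swap_apply_def]⟩, ?_,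
    ⟨some false, by simp [kinkEquiv]⟩, rfl, ?_⟩
  · rintro (_ | (_ | _)) ho
    · exact ⟨some true, by simp [kinkEquiv, Equiv.swap_apply_def]⟩
    · simp at ho
    · exact ⟨none, by simp [kinkEquiv]⟩
  · rintro (_ | (_ | _)) ho
    · simp at ho
    · exact Or.inl (by simp [kinkEquiv])
    · simp at ho
  · rintro (_ | (_ | _))
    · exact Smoothing.comp_eq _ ((hnext (Sum.inr none)).trans
        (by simp [kinkEquiv, Equiv.swap_apply_def]; rfl))
    · exact (Smoothing.comp_eq _ ((hnext (Sum.inl s)).trans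
        (by simp [kinkEquiv, Equiv.swap_apply_def]; rfl))).symm
    · rfl

/-- In the `0`-resolution of the positive kink `posKinkIn`, the edge `out false` forms a circle. -/
theorem splits_posKinkIn {ε : D.V → Bool} {ε' : Option D.V → Bool}
    (h : ∀ v, ε' (some v) = ε v) (h' : ε' none = false) :
    SplitsCircle (D.next.trans (resolve n ε))
      (((D.kink s ov).surger (D.embed s ov s) (D.out s ov false)).next.trans (resolve n ε')) s
      (some false) (fun o => o == some false)
      (fun y => (kinkEquiv D.next s (Equiv.swap (Sum.inl s) (Sum.inr (some false)) y)).map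
        (resolve n ε) fun o => o) := by
  have hnext := D.surger_split s ov h h' (Sum.inl s) (Sum.inr (some false))
  have h0 : Smoothing.comp ⟨_, ((D.kink s ov).surger (D.embed s ov s)
      (D.out s ov false)).next.trans (resolve n ε')⟩ ((split D.V D.L n).symm (Sum.inr none)) =
      Smoothing.comp ⟨_, ((D.kink s ov).surger (D.embed s ov s)
      (D.out s ov false)).next.trans (resolve n ε')⟩ ((split D.V D.L n).symm (Sum.inl s)) :=
    (Smoothing.comp_eq _ ((hnext (Sum.inl s)).trans (by simp [kinkEquiv]; rfl))).symm
  refine ⟨hnext, fun e he => by simp [kinkEquiv, Equiv.swap_apply_def, he], ?_,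
    ⟨none, by simp [kinkEquiv]⟩, ?_, ⟨some true, by simp [kinkEquiv, Equiv.swap_apply_def]⟩,
    rfl, ?_⟩
  · rintro (_ | (_ | _)) ho
    · simp at ho
    · exact ⟨some false, by simp [kinkEquiv]⟩
    · simp at ho
  · rintro (_ | (_ | _)) ho
    · exact Or.inr ⟨some true, by simp [kinkEquiv, Equiv.swap_apply_def]⟩
    · simp at ho
    · exact Or.inl (by simp [kinkEquiv, Equiv.swap_apply_def])
  · rintro (_ | (_ | _))
    · exact h0
    · rfl
    · exact (Smoothing.comp_eq _ ((hnext (Sum.inr none)).trans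
        (by simp [kinkEquiv, Equiv.swap_apply_def]; rfl))).symm.trans h0

end Diagram

/-! ## The elementary movies that occur -/

/-- Two edges are on the boundary of a common region. -/
def Diagram.SameRegion (D : Diagram n) (e e' : D.Edge) : Prop :=
  D.leftTurn.SameCycle e e' ∨ D.rightTurn.SameCycle e e'

namespace Tangle

/-- The Reidemeister I map of a tangle with values in its negative kink: the birth of the circle in
the `1`-resolution of the kink. -/
def addKinkMap (T : Tangle E) (s : T.Edge) (ov : Bool) : T.CBN ⟶ (T.negKink s ov).CBN :=
  fun (ε : T.V → Bool) (ε' : Option T.V → Bool) =>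
    if h : (∀ v, ε' (some v) = ε v) ∧ ε' none = true then
      entry (T' := T.negKink s ov) (ε' := ε')
        (Cob.birth (T.diagram.smoothing ε) ≫ (T.diagram.splits_negKink s ov h.1 h.2).cylinder)
    else 0

/-- The Reidemeister I map from the positive kink `posKinkOut`: the death of the circle in the
`0`-resolution of the kink. -/
def removeKinkOutMap (T : Tangle E) (s : T.Edge) (ov : Bool) : (T.posKinkOut s ov).CBN ⟶ T.CBN :=
  fun (ε' : Option T.V → Bool) (ε : T.V → Bool) =>
    if h : (∀ v, ε' (some v) = ε v) ∧ ε' none = false then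
      entry (T := T.posKinkOut s ov) (ε := ε')
        ((T.diagram.splits_posKinkOut s ov h.1 h.2).cylinderInv ≫
          Cob.death (T.diagram.smoothing ε))
    else 0

/-- The Reidemeister I map from the positive kink `posKinkIn`: the death of the circle in the
`0`-resolution of the kink. -/
def removeKinkInMap (T : Tangle E) (s : T.Edge) (ov : Bool) : (T.posKinkIn s ov).CBN ⟶ T.CBN :=
  fun (ε' : Option T.V → Bool) (ε : T.V → Bool) =>
    if h : (∀ v, ε' (some v) = ε v) ∧ ε' none = false then
      entry (T := T.posKinkIn s ov) (ε := ε')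
        ((T.diagram.splits_posKinkIn s ov h.1 h.2).cylinderInv ≫
          Cob.death (T.diagram.smoothing ε))
    else 0

/-- The tangle after a saddle movie along a band joining two edges, with an orientation. -/
def surger (T : Tangle E) (s t : T.Edge) (o : Orientation E (T.diagram.surger s t)) : Tangle E where
  diagram := T.diagram.surger s t
  orientation := o

/-- The map of a saddle movie: the sum of the saddle cobordisms over all resolutions. -/
def saddleMap (T : Tangle E) {s t : T.Edge} (hst : s ≠ t)
    (o : Orientation E (T.diagram.surger s t)) : T.CBN ⟶ (T.surger s t o).CBN :=
  fun (ε ε' : T.V → Bool) =>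
    if h : ε = ε' then
      entry (T' := T.surger s t o) (ε' := ε') (T.diagram.saddle hst h)
    else 0

end Tangle

/-- A tangle with basepoints of the colour `x`, each on some edge, away from the crossings. -/
structure PTangle (E : Ends) where
  tangle : Tangle E
  basepoints : Multiset tangle.Edge

/-- Elementary movies: adding or removing two basepoints which are not separated by a crossing (cup
and cap movies, where the decoration is a short arc joining the basepoints), sliding a basepoint
along its strand through a crossing, saddle movies (the basepoints on `s` and `t` are before the feet
of the band), and Reidemeister I movies. Apart from slides, and outside the short arcs, the
decoration is vertical. -/
inductive Step {E : Ends} : PTangle E → PTangle E → Type 1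
  | cup (T : Tangle E) (P : Multiset T.Edge) (p q : T.Edge) (h : T.diagram.Adjacent p q) :
      Step ⟨T, P⟩ ⟨T, p ::ₘ q ::ₘ P⟩
  | cap (T : Tangle E) (P : Multiset T.Edge) (p q : T.Edge) (h : T.diagram.Adjacent p q) :
      Step ⟨T, p ::ₘ q ::ₘ P⟩ ⟨T, P⟩
  | slide (T : Tangle E) (P : Multiset T.Edge) (p q : T.Edge) (v : T.V)
      (h : T.diagram.Opposite v p q) : Step ⟨T, p ::ₘ P⟩ ⟨T, q ::ₘ P⟩
  | saddle (T : Tangle E) (P : Multiset T.Edge) (s t : T.Edge) (hst : s ≠ t)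
      (h : T.diagram.SameRegion s t) (o : Orientation E (T.diagram.surger s t)) :
      Step ⟨T, P⟩ ⟨T.surger s t o, P⟩
  | addKink (T : Tangle E) (P : Multiset T.Edge) (s : T.Edge) (ov : Bool) :
      Step ⟨T, P⟩ ⟨T.negKink s ov, P.map (T.diagram.embed s ov)⟩
  | removeKinkOut (T : Tangle E) (P : Multiset T.Edge) (s : T.Edge) (ov : Bool) :
      Step ⟨T.posKinkOut s ov, P.map (T.diagram.embed s ov)⟩ ⟨T, P⟩
  | removeKinkIn (T : Tangle E) (P : Multiset T.Edge) (s : T.Edge) (ov : Bool) :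
      Step ⟨T.posKinkIn s ov, P.map (T.diagram.embed s ov)⟩ ⟨T, P⟩

/-- Movies: finite sequences of elementary movies. -/
inductive Movie {E : Ends} : PTangle E → PTangle E → Type 1
  | nil (P : PTangle E) : Movie P P
  | cons {P Q R : PTangle E} (f : Step P Q) (g : Movie Q R) : Movie P R

/-! ## The enhanced complex and the enhanced maps -/

/-- `RX ⊗ Ξ` as a bigraded vector space. -/
abbrev grRXi : GrVect := grRX.tensor grXi

/-- The map `1 ⊗ ξ` of `RX ⊗ Ξ`. -/
def xi : grRXi.carrier →ₗ[F₂] grRXi.carrier :=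
  TensorProduct.map (LinearMap.id : RX →ₗ[F₂] RX) mulXi

/-- The map `r ⊗ 1` of `RX ⊗ Ξ`. -/
def mulR (r : RX) : grRXi.carrier →ₗ[F₂] grRXi.carrier :=
  TensorProduct.map (LinearMap.mulLeft F₂ r) (LinearMap.id : Xi →ₗ[F₂] Xi)

namespace PTangle

variable {E : Ends}

/-- The object `C_BN(T) ⊗ RX ⊗ Ξ`. -/
def Dbar (P : PTangle E) : BN E.n := tensorObj P.tangle.CBN grRXi

/-- The action of `x` on `C_BN(T)`: the sum of the basepoint actions. -/
def rho (P : PTangle E) : P.tangle.CBN ⟶ P.tangle.CBN :=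
  (P.basepoints.map P.tangle.basepoint).sum

/-- The differential `∂ ⊗ 1 ⊗ 1 + (ρ(x) ⊗ 1 + 1 ⊗ x) ⊗ ξ`. -/
def differential (P : PTangle E) : P.Dbar ⟶ P.Dbar :=
  tensorHom P.tangle.d LinearMap.id + (tensorHom P.rho xi +
    tensorHom (𝟙 P.tangle.CBN) (xi ∘ₗ mulR RX.x))

/-- The action of `r ∈ RX`. -/
def act (P : PTangle E) (r : RX) : P.Dbar ⟶ P.Dbar :=
  tensorHom (𝟙 P.tangle.CBN) (mulR r)

/-- Multiplication by `ξ`. -/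
def mulXi (P : PTangle E) : P.Dbar ⟶ P.Dbar :=
  tensorHom (𝟙 P.tangle.CBN) xi

end PTangle

/-- The enhanced map of an elementary movie: `f ⊗ 1 ⊗ 1`, where `f` is the map on `C_BN`, except that
a slide induces `1 ⊗ 1 ⊗ 1 + H ⊗ 1 ⊗ ξ`. -/
def Step.Dbar {E : Ends} {P Q : PTangle E} (f : Step P Q) : P.Dbar ⟶ Q.Dbar :=
  match f with
  | cup T _ _ _ _ => tensorHom (𝟙 T.CBN) LinearMap.id
  | cap T _ _ _ _ => tensorHom (𝟙 T.CBN) LinearMap.id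
  | slide T _ _ _ v _ =>
      tensorHom (𝟙 T.CBN) LinearMap.id + tensorHom (T.slideHomotopy v) xi
  | saddle T _ _ _ hst _ o => tensorHom (T.saddleMap hst o) LinearMap.id
  | addKink T _ s ov => tensorHom (T.addKinkMap s ov) LinearMap.id
  | removeKinkOut T _ s ov => tensorHom (T.removeKinkOutMap s ov) LinearMap.id
  | removeKinkIn T _ s ov => tensorHom (T.removeKinkInMap s ov) LinearMap.id

/-- The enhanced map of a movie. -/
def Movie.Dbar {E : Ends} {P Q : PTangle E} : Movie P Q → (P.Dbar ⟶ Q.Dbar)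
  | .nil P => 𝟙 P.Dbar
  | .cons f g => f.Dbar ≫ g.Dbar

/-! ## The standard projective plane with Euler number `-2` -/

namespace Tangle

variable {E : Ends} (T : Tangle E) (s : T.Edge) (ov : Bool)

theorem kink_next_out_false :
    (T.diagram.kink s ov).next (T.diagram.out s ov false) = T.diagram.loop s ov := rfl

theorem kink_next_loop :
    (T.diagram.kink s ov).next (T.diagram.loop s ov) = T.diagram.out s ov true := rfl

theorem kink_next_embed :
    (T.diagram.kink s ov).next (T.diagram.embed s ov s) = T.diagram.out s ov false := by
  show (Diagram.split _ _ _).symm (Diagram.kinkEquiv T.diagram.next s (Diagram.split _ _ _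
    ((Diagram.split _ _ _).symm (Sum.inl s)))) = _
  rw [Equiv.apply_symm_apply]
  simp [Diagram.kinkEquiv]
  rfl

theorem embed_ne_out (i : Bool) : T.diagram.embed s ov s ≠ T.diagram.out s ov i :=
  fun h => by simpa using (Diagram.split _ _ _).symm.injective h

theorem embed_ne_loop : T.diagram.embed s ov s ≠ T.diagram.loop s ov :=
  fun h => by simpa using (Diagram.split _ _ _).symm.injective h

theorem loop_ne_out (i : Bool) : T.diagram.loop s ov ≠ T.diagram.out s ov i :=
  fun h => by simpa using (Diagram.split _ _ _).symm.injective h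

theorem out_ne_out : T.diagram.out s ov false ≠ T.diagram.out s ov true :=
  fun h => by simpa using (Diagram.split _ _ _).symm.injective h

theorem kink_opposite_out : (T.posKinkOut s ov).diagram.Opposite none
    (T.diagram.out s ov false) (T.diagram.out s ov true) :=
  ⟨false, Or.inl ⟨rfl, rfl⟩⟩

theorem kink_opposite_in : (T.posKinkIn s ov).diagram.Opposite none
    (T.diagram.loop s ov) (T.diagram.out s ov false) := by
  refine ⟨true, Or.inr ⟨?_, ?_⟩⟩
  · show (T.diagram.kink s ov).next (Equiv.swap _ _ (T.diagram.loop s ov)) = _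
    rw [Equiv.swap_apply_of_ne_of_ne (T.embed_ne_loop s ov).symm (T.loop_ne_out s ov false),
      kink_next_loop]
    rfl
  · show (T.diagram.kink s ov).next (Equiv.swap _ _ (T.diagram.out s ov false)) = _
    rw [Equiv.swap_apply_right, kink_next_embed]
    rfl

theorem kink_adjacent_neg : (T.negKink s ov).diagram.Adjacent
    (T.diagram.out s ov false) (T.diagram.loop s ov) :=
  Or.inr ⟨none, Or.inl ⟨T.kink_next_out_false s ov, rfl⟩⟩

theorem kink_adjacent_neg_symm : (T.negKink s ov).diagram.Adjacent
    (T.diagram.loop s ov) (T.diagram.out s ov false) :=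
  Or.inr ⟨none, Or.inr ⟨T.kink_next_out_false s ov, rfl⟩⟩

theorem kink_adjacent_out : (T.posKinkOut s ov).diagram.Adjacent
    (T.diagram.out s ov true) (T.diagram.loop s ov) := by
  refine Or.inr ⟨none, Or.inl ⟨?_, rfl⟩⟩
  show (T.diagram.kink s ov).next (Equiv.swap
    (T.diagram.out s ov false) (T.diagram.out s ov true) (T.diagram.out s ov true)) = _
  rw [Equiv.swap_apply_right, kink_next_out_false]
  rfl

theorem kink_region_out : (T.negKink s ov).diagram.SameRegion
    (T.diagram.out s ov false) (T.diagram.out s ov true) := by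
  have h : ∀ ε : Option T.V → Bool, ε none = false →
      Diagram.resolve E.n ε ((T.diagram.kink s ov).next (Diagram.resolve E.n ε
        ((T.diagram.kink s ov).next (T.diagram.out s ov false)))) = T.diagram.out s ov true := by
    intro ε hε
    rw [kink_next_out_false]
    show Diagram.resolve E.n ε ((T.diagram.kink s ov).next (T.diagram.loop s ov)) = _
    rw [kink_next_loop]
    show Sum.inl (Sum.inl (none, xor true (ε none))) = _
    rw [hε]
    rfl
  cases ov
  · exact Or.inr ⟨2, h _ rfl⟩
  · refine Or.inl ⟨2, ?_⟩
    have h' := congrArg (Diagram.rotate E.n) (h (fun v => !(T.diagram.kink s true).overIn v) rfl)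
    exact h'

theorem kink_region_in : (T.negKink s ov).diagram.SameRegion
    (T.diagram.embed s ov s) (T.diagram.out s ov false) := by
  have h : ∀ ε : Option T.V → Bool, ε none = false →
      Diagram.resolve E.n ε ((T.diagram.kink s ov).next (T.diagram.embed s ov s)) =
        T.diagram.out s ov false := by
    intro ε hε
    rw [kink_next_embed]
    show Sum.inl (Sum.inl (none, xor false (ε none))) = _
    rw [hε]
    rfl
  cases ov
  · exact Or.inr ⟨1, h _ rfl⟩
  · exact Or.inl ⟨1, congrArg (Diagram.rotate E.n)
      (h (fun v => !(T.diagram.kink s true).overIn v) rfl)⟩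

/-- The movie of the connected sum of `I × T` with the standard `ℝP²` of Euler number `-2`, decorated
by its core: add a negative kink to the edge `s`; add two basepoints on its loop, on both sides of
the foot of a band; do a saddle movie along the band, which gives a positive kink; slide one of the
basepoints through the crossing, so that it meets the other one; remove the two basepoints; remove
the positive kink. The other foot of the band is on the edge at which the kink is left, or on the
edge at which it is entered, depending on the last argument. -/
def rp2Movie : Bool → Movie (⟨T, 0⟩ : PTangle E) ⟨T, 0⟩
  | false =>
    .cons (.addKink T 0 s ov) <|
    .cons (.cup (T.negKink s ov) 0 (T.diagram.out s ov false) (T.diagram.loop s ov)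
      (T.kink_adjacent_neg s ov)) <|
    .cons (.saddle (T.negKink s ov) _ (T.diagram.out s ov false) (T.diagram.out s ov true)
      (T.out_ne_out s ov) (T.kink_region_out s ov) (T.posKinkOut s ov).orientation) <|
    .cons (.slide (T.posKinkOut s ov) _ (T.diagram.out s ov false) (T.diagram.out s ov true) none
      (T.kink_opposite_out s ov)) <|
    .cons (.cap (T.posKinkOut s ov) 0 (T.diagram.out s ov true) (T.diagram.loop s ov)
      (T.kink_adjacent_out s ov)) <|
    .cons (.removeKinkOut T 0 s ov) <|
    .nil _
  | true =>
    .cons (.addKink T 0 s ov) <|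
    .cons (.cup (T.negKink s ov) 0 (T.diagram.loop s ov) (T.diagram.out s ov false)
      (T.kink_adjacent_neg_symm s ov)) <|
    .cons (.saddle (T.negKink s ov) _ (T.diagram.embed s ov s) (T.diagram.out s ov false)
      (T.embed_ne_out s ov false) (T.kink_region_in s ov) (T.posKinkIn s ov).orientation) <|
    .cons (.slide (T.posKinkIn s ov) _ (T.diagram.loop s ov) (T.diagram.out s ov false) none
      (T.kink_opposite_in s ov)) <|
    .cons (.cap (T.posKinkIn s ov) 0 (T.diagram.out s ov false) (T.diagram.out s ov false)
      (Or.inl rfl)) <|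
    .cons (.removeKinkIn T 0 s ov) <|
    .nil _

end Tangle

end
end BNTangle

namespace BNTangle

noncomputable section

variable {n : ℕ}

/-! ## Cancelling a birth or a death against a saddle -/

namespace Smoothing

/-! The only step of the movie that involves `ξ` is the slide, which contributes `1 + H_c ⊗ ξ`.
Writing `A` for the birth map of the negative kink, `S` for the saddle map and `R` for the death map
of the positive kink, the enhanced map is therefore `(A ≫ S ≫ R) ⊗ 1 + (A ≫ S ≫ H_c ≫ R) ⊗ ξ`; the
cup and the cap contribute identities (`tensorHom_slide`).

The first term is zero because `A` lands in the resolutions that are `1` at the new crossing, `S`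
does not change the resolution, and `R` is supported on the resolutions that are `0` there. In the
second term `H_c` changes exactly this `1` to `0`, so for every resolution `ε` of `T` a single path
survives: birth of a circle, saddle along the band, saddle at the crossing, death of a circle. This
path returns to `ε`, so the composite is diagonal (`kink_cancel`).

The diagonal entry is the identity by Morse cancellation, used twice (`birth_saddle_saddle_death`).
The first saddle joins the newborn circle to the component of `s`, so birth and saddle together are
a product cobordism; the second saddle splits a circle off the component of `s`, and its death
cancels it. This already holds for cobordisms, before the local relations are imposed. Since a
cobordism is recorded by its components, their Euler characteristics and dots, cancellation is a
computation with gluings: the disk adds `1` to the Euler characteristic of a component, the band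
subtracts `1`, and no component is lost or duplicated.

Both products are described by one labelling of the segments of the kinked diagram by the components
of the original resolution, in which every new segment carries the label of `s` (`kinkLabel`). It is
constant along the components of the resolution that splits off a circle, and a surgery between two
equally labelled segments preserves this. The two positions of the band differ only in which
segments lie on the circles, which is the content of `Joins`.

Once the map is known to be `1 ⊗ ξ`, it is an `R_x`-linear chain map because `ξ` acts on a tensor
factor of its own and commutes with everything else. -/

/-- A map on components that fixes the starts of the arcs preserves Euler characteristics. -/
theorem euler_mapDomain (a b : Smoothing n) (φ : a.Comp → b.Comp)
    (hφ : ∀ i, φ (a.comp (Sum.inr i)) = b.comp (Sum.inr i)) : a.euler.mapDomain φ = b.euler := by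
  simp [euler, Finsupp.mapDomain_finsetSum, Finsupp.mapDomain_single, hφ]

/-- The map on components induced by a function on segments that is constant along them. -/
def compLift (a : Smoothing n) {S : Type} (r : a.Seg → S)
    (hr : ∀ e x, a.next e = Sum.inl x → r e = r (Sum.inl x)) : a.Comp → S :=
  Quot.lift r (by rintro e _ ⟨x, hx, rfl⟩; exact hr e x hx)

/-- Merges the circle of a disjoint union into the component `p`. -/
def mergeCircle (a : Smoothing n) (p : a.Comp) : a.addCircle.Comp → a.Comp :=
  a.addCircleLift a.comp p (fun _ _ h => a.comp_eq h)

theorem mergeCircle_toAddCircle (a : Smoothing n) (p q : a.Comp) :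
    a.mergeCircle p (a.toAddCircle q) = q := by
  induction q using Quot.ind with | _ e => exact a.addCircleLift_toAddCircle _ _ _ e

end Smoothing

/-- A function that is constant along the components before a surgery, and agrees on the two
segments of the surgery, is constant along the components after it. -/
theorem IsSurgery.label {X : Type} {f g : X ⊕ Fin n ≃ X ⊕ Fin n} {s t : X ⊕ Fin n}
    (h : IsSurgery f g s t) {S : Type} {r : X ⊕ Fin n → S} (hst : r s = r t)
    (hr : ∀ e x, f e = Sum.inl x → r e = r (Sum.inl x)) (e : X ⊕ Fin n) (x : X)
    (he : g e = Sum.inl x) : r e = r (Sum.inl x) := by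
  -- After the surgery `s` ends where `t` ended and conversely. As both carry the same label, the
  -- label of the new end still agrees.
  by_cases hs : e = s
  · subst hs
    exact hst.trans (hr _ _ (h.left.symm.trans he))
  by_cases ht : e = t
  · subst ht
    exact hst.symm.trans (hr _ _ (h.right.symm.trans he))
  exact hr _ _ ((h.other e hs ht).symm.trans he)

/-! ### Gluing disks, saddles and products -/

namespace PreCob

/-- `I × b` as a cobordism from `a`, where the circle `c` of `b` is closed off by a disk, and `ι`
sends the components of `a` to the other components of `b`. -/
def capped (a b : Smoothing n) (ι : a.Comp → b.Comp) (c : b.Comp) : PreCob a b where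
  S := b.Comp
  source := ι
  target := fun p => p
  euler := b.euler + Finsupp.single c 1
  dots := 0

/-- The reverse of `capped`. -/
def cappedRev (a b : Smoothing n) (ι : a.Comp → b.Comp) (c : b.Comp) : PreCob b a where
  S := b.Comp
  source := fun p => p
  target := ι
  euler := b.euler + Finsupp.single c 1
  dots := 0

/-- The cobordism from `a` to `b` whose components are those of `I × a`, for a map `l` of the
components of `b` to those of `a`. -/
def labelled (a b : Smoothing n) (l : b.Comp → a.Comp) : PreCob a b where
  S := a.Comp
  source := fun p => p
  target := l
  euler := a.euler
  dots := 0

/-- The reverse of `labelled`. -/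
def labelledRev (a b : Smoothing n) (l : b.Comp → a.Comp) : PreCob b a where
  S := a.Comp
  source := l
  target := fun p => p
  euler := a.euler
  dots := 0

/-- The cylinder only renames components, so `φ` itself collapses the gluing. The Euler
characteristic of the circle-augmented manifold cancels against the correction along the gluing
locus; what is left is that of `b` and the `1` of the disk. -/
theorem birth_comp_cylinder (a b : Smoothing n) (φ : a.addCircle.Comp ≃ b.Comp) :
    comp (birth a) (cylinder _ b φ) ≈
      capped a b (fun p => φ (a.toAddCircle p)) (φ a.newCircle) := by
  refine comp_equivalent _ _ (capped a b (fun p => φ (a.toAddCircle p)) (φ a.newCircle))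
    φ (fun s => s) (fun _ => rfl)
    (fun s => Quot.mk _ (Sum.inr s)) (fun p => (glue (birth a) (cylinder _ b φ) p).symm)
    (fun _ => rfl) (fun s => Or.inr ⟨s, rfl⟩) (fun _ => rfl) (fun _ => rfl) ?_ ?_
  · have key : (a.addCircle.euler + Finsupp.single a.newCircle 1).mapDomain φ +
        b.euler.mapDomain _root_.id - a.addCircle.euler.mapDomain φ =
          b.euler + Finsupp.single (φ a.newCircle) 1 := by
      rw [Finsupp.mapDomain_add, Finsupp.mapDomain_id, Finsupp.mapDomain_single]
      abel
    exact key
  · show Finsupp.mapDomain φ (0 : a.addCircle.Comp →₀ ℕ) +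
      Finsupp.mapDomain _root_.id (0 : b.Comp →₀ ℕ) = 0
    simp

/-- Unlike for the birth, the cylinder now carries the Euler characteristic of the circle-augmented
manifold. It has to be transported to `b`, and for this `φ` must fix the starts of the arcs. -/
theorem cylinder_comp_death (a b : Smoothing n) (φ : a.addCircle.Comp ≃ b.Comp)
    (hφ : ∀ i, φ (a.addCircle.comp (Sum.inr i)) = b.comp (Sum.inr i)) :
    comp (cylinder b _ φ.symm) (death a) ≈
      cappedRev a b (fun p => φ (a.toAddCircle p)) (φ a.newCircle) := by
  refine comp_equivalent _ _ (cappedRev a b (fun p => φ (a.toAddCircle p)) (φ a.newCircle))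
    φ φ (fun _ => rfl) (fun s => Quot.mk _ (Sum.inl (φ.symm s)))
    (fun p => congrArg (fun z => Quot.mk _ (Sum.inl z)) (φ.symm_apply_apply p))
    (fun p => (congrArg (fun z => Quot.mk _ (Sum.inl z)) (φ.symm_apply_apply p)).trans
      (glue (cylinder b _ φ.symm) (death a) p))
    (fun s => Or.inl (φ.surjective s)) (fun p => φ.apply_symm_apply p) (fun _ => rfl) ?_ ?_
  · have key : a.addCircle.euler.mapDomain φ +
        (a.addCircle.euler + Finsupp.single a.newCircle 1).mapDomain φ -
        a.addCircle.euler.mapDomain φ = b.euler + Finsupp.single (φ a.newCircle) 1 := by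
      rw [Finsupp.mapDomain_add, Finsupp.mapDomain_single, Smoothing.euler_mapDomain _ b φ hφ]
      abel
    exact key
  · show Finsupp.mapDomain φ (0 : a.addCircle.Comp →₀ ℕ) +
      Finsupp.mapDomain φ (0 : a.addCircle.Comp →₀ ℕ) = 0
    simp

/-- A disk glued to a saddle that merges its boundary `c` with `ι p`. -/
theorem capped_comp {a b m : Smoothing n} (ι : a.Comp → b.Comp) (c : b.Comp) (p : a.Comp)
    (ρ : b.Comp → a.Comp) (l : m.Comp → a.Comp) (σ : PreCob b m) (v : σ.S → a.Comp)
    (hρι : ∀ q, ρ (ι q) = q) (hρc : ρ c = p) (hb : ∀ q, q = c ∨ ∃ q', q = ι q')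
    (hvs : ∀ q, v (σ.source q) = ρ q) (hvt : ∀ q, v (σ.target q) = l q)
    (hσ : Function.Surjective σ.source) (hc : σ.source c = σ.source (ι p))
    (he : σ.euler.mapDomain v = a.euler - Finsupp.single p 1) (hd : σ.dots = 0) :
    comp (capped a b ι c) σ ≈ labelled a m l := by
  -- The image of `ι` represents every component of the glued surface: for the boundary `c` of the
  -- disk one crosses into `σ` at `ι p` and comes back at `c`, since `σ` connects the two.
  have hw : ∀ q : b.Comp, (Quot.mk _ (Sum.inl (ι (ρ q))) : Quot (GlueRel (capped a b ι c) σ)) =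
      Quot.mk _ (Sum.inl q) := by
    intro q
    rcases hb q with rfl | ⟨q, rfl⟩
    · rw [hρc]
      refine (glue (capped a b ι q) σ (ι p)).trans (Eq.trans ?_ (glue (capped a b ι q) σ q).symm)
      rw [hc]
    · exact congrArg (fun z => Quot.mk _ (Sum.inl (ι z))) (hρι q)
  refine comp_equivalent (capped a b ι c) σ (labelled a m l) ρ v (fun q => (hvs q).symm)
    (fun q => Quot.mk _ (Sum.inl (ι q))) hw ?_ (fun q => Or.inl ⟨ι q, hρι q⟩) hρι hvt ?_ ?_
  -- Every component of `σ` meets `b`, so it suffices to check the components that are reached from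
  -- there.
  · intro s
    obtain ⟨q, rfl⟩ := hσ s
    rw [hvs]
    exact (hw q).trans (glue (capped a b ι c) σ q)
  -- The `+1` of the disk at `c` is moved by `ρ` to `p`, where it meets the `-1` of the band.
  · have key : (b.euler + Finsupp.single c 1).mapDomain ρ + σ.euler.mapDomain v -
        b.euler.mapDomain ρ = a.euler := by
      rw [he, Finsupp.mapDomain_add, Finsupp.mapDomain_single, hρc]
      abel
    exact key
  · have key : (0 : b.Comp →₀ ℕ).mapDomain ρ + σ.dots.mapDomain v = 0 := by
      rw [hd, Finsupp.mapDomain_zero, Finsupp.mapDomain_zero, add_zero]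
    exact key

/-- A saddle that splits off `c` from `ι p`, glued to a disk. -/
theorem comp_cappedRev {a b m : Smoothing n} (ι : a.Comp → b.Comp) (c : b.Comp) (p : a.Comp)
    (ρ : b.Comp → a.Comp) (l : m.Comp → a.Comp) (σ : PreCob m b) (v : σ.S → a.Comp)
    (hρι : ∀ q, ρ (ι q) = q) (hρc : ρ c = p) (hb : ∀ q, q = c ∨ ∃ q', q = ι q')
    (hvs : ∀ q, v (σ.source q) = l q) (hvt : ∀ q, v (σ.target q) = ρ q)
    (hσ : Function.Surjective σ.target) (hc : σ.target c = σ.target (ι p))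
    (he : σ.euler.mapDomain v = a.euler - Finsupp.single p 1) (hd : σ.dots = 0) :
    comp σ (cappedRev a b ι c) ≈ labelledRev a m l := by
  -- The same detour through `σ`, which now lies on the other side of `b`.
  have hw : ∀ q : b.Comp, (Quot.mk _ (Sum.inr (ι (ρ q))) : Quot (GlueRel σ (cappedRev a b ι c))) =
      Quot.mk _ (Sum.inr q) := by
    intro q
    rcases hb q with rfl | ⟨q, rfl⟩
    · rw [hρc]
      refine (glue σ (cappedRev a b ι q) (ι p)).symm.trans
        (Eq.trans ?_ (glue σ (cappedRev a b ι q) q))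
      rw [hc]
    · exact congrArg (fun z => Quot.mk _ (Sum.inr (ι z))) (hρι q)
  refine comp_equivalent σ (cappedRev a b ι c) (labelledRev a m l) v ρ hvt
    (fun q => Quot.mk _ (Sum.inr (ι q))) ?_ hw (fun q => Or.inr ⟨ι q, hρι q⟩) hvs hρι ?_ ?_
  · intro s
    obtain ⟨q, rfl⟩ := hσ s
    rw [hvt]
    exact (hw q).trans (glue σ (cappedRev a b ι c) q).symm
  -- Here `σ` comes first, so the correction along `b` is pushed forward through `σ.target`; by
  -- `hvt` this is again `ρ`, and `+1` and `-1` cancel as before.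
  · have key : σ.euler.mapDomain v + (b.euler + Finsupp.single c 1).mapDomain ρ -
        b.euler.mapDomain (fun q => v (σ.target q)) = a.euler := by
      rw [he, Finsupp.mapDomain_add, Finsupp.mapDomain_single, hρc, funext hvt]
      abel
    exact key
  · have key : σ.dots.mapDomain v + (0 : b.Comp →₀ ℕ).mapDomain ρ = 0 := by
      rw [hd, Finsupp.mapDomain_zero, Finsupp.mapDomain_zero, add_zero]
    exact key

/-- Surjectivity of `l` glues each component of the first copy of `I × a` to its twin in the second
copy, so the copies collapse to one. The Euler characteristics add up to twice that of `a`, minus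
that of `m`, which `l` carries to that of `a`. -/
theorem labelled_comp_labelledRev (a m : Smoothing n) (l : m.Comp → a.Comp)
    (hl : Function.Surjective l) (he : m.euler.mapDomain l = a.euler) :
    comp (labelled a m l) (labelledRev a m l) ≈ id a := by
  refine comp_equivalent (labelled a m l) (labelledRev a m l) (id a) (fun q => q) (fun q => q)
    (fun _ => rfl) (fun q => Quot.mk _ (Sum.inl q)) (fun _ => rfl) ?_ (fun q => Or.inl ⟨q, rfl⟩)
    (fun _ => rfl) (fun _ => rfl) ?_ ?_
  · intro q
    obtain ⟨q, rfl⟩ := hl q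
    exact glue (labelled a m l) (labelledRev a m l) q
  · show a.euler.mapDomain _root_.id + a.euler.mapDomain _root_.id - m.euler.mapDomain l = a.euler
    rw [he, Finsupp.mapDomain_id]
    abel
  · show Finsupp.mapDomain _root_.id (0 : a.Comp →₀ ℕ) +
      Finsupp.mapDomain _root_.id (0 : a.Comp →₀ ℕ) = 0
    simp

section Saddle

variable {X : Type} [Fintype X] [DecidableEq X] {f g : X ⊕ Fin n ≃ X ⊕ Fin n} {s t : X ⊕ Fin n}
  (h : IsSurgery f g s t)

/-- A component of a saddle is a class of segments, and source and target have the same segments.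
Thus no component is disjoint from either end, and gluings can be checked on one end. -/
theorem saddle_source_surjective : Function.Surjective (saddle f g s t h).source := by
  intro q
  induction q using Quot.ind with | _ e => exact ⟨Quot.mk _ e, rfl⟩

theorem saddle_target_surjective : Function.Surjective (saddle f g s t h).target := by
  intro q
  induction q using Quot.ind with | _ e => exact ⟨Quot.mk _ e, rfl⟩

/-- The map on the components of a saddle induced by a function on segments. -/
def saddleLift {S : Type} (r : X ⊕ Fin n → S) (hst : r s = r t)
    (hr : ∀ e x, f e = Sum.inl x → r e = r (Sum.inl x)) : (saddle f g s t h).S → S :=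
  Quot.lift r (by
    rintro _ _ (⟨x, hx, rfl⟩ | ⟨rfl, rfl⟩)
    · exact hr _ _ hx
    · exact hst)

/-- The subtracted `1` is the band, which sits on the component with the common label of its feet.
This is the form in which the gluing lemmas above take the Euler characteristic of `σ`. -/
theorem saddle_euler {S : Type} (r : X ⊕ Fin n → S) (hst : r s = r t)
    (hr : ∀ e x, f e = Sum.inl x → r e = r (Sum.inl x)) :
    (saddle f g s t h).euler.mapDomain (saddleLift h r hst hr) =
      (Smoothing.euler ⟨X, f⟩).mapDomain (Smoothing.compLift ⟨X, f⟩ r hr) -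
        Finsupp.single (r s) 1 := by
  refine (mapDomain_sub _ _ _).trans (congrArg₂ _ ?_ Finsupp.mapDomain_single)
  refine Finsupp.mapDomain_comp.symm.trans (congrArg (Finsupp.mapDomain · _) (funext fun q => ?_))
  induction q using Quot.ind with | _ e => rfl

end Saddle

end PreCob

/-! ### Morse cancellation at a kink -/

namespace Diagram

/-- Labels the segments of a resolution of a diagram with a kink on `s` by the components of the
resolution without the kink; all new segments have the label of `s`. -/
def kinkLabel {V L : Type} [Fintype V] [DecidableEq V] [Fintype L] [DecidableEq L]
    (f : ((V × Bool) ⊕ L) ⊕ Fin n ≃ ((V × Bool) ⊕ L) ⊕ Fin n) (s : ((V × Bool) ⊕ L) ⊕ Fin n)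
    (e : ((Option V × Bool) ⊕ Option L) ⊕ Fin n) : (Smoothing.mk _ f).Comp :=
  Sum.elim (Smoothing.comp ⟨_, f⟩) (fun _ => Smoothing.comp ⟨_, f⟩ s) (split V L n e)

namespace SplitsCircle

variable {V L : Type} [Fintype V] [DecidableEq V] [Fintype L] [DecidableEq L]
  {f : ((V × Bool) ⊕ L) ⊕ Fin n ≃ ((V × Bool) ⊕ L) ⊕ Fin n}
  {g : ((Option V × Bool) ⊕ Option L) ⊕ Fin n ≃ ((Option V × Bool) ⊕ Option L) ⊕ Fin n}
  {s : ((V × Bool) ⊕ L) ⊕ Fin n} {c : Option Bool} {onCircle : Option Bool → Bool}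
  {N : (((V × Bool) ⊕ L) ⊕ Fin n) ⊕ Option Bool → (((V × Bool) ⊕ L) ⊕ Fin n) ⊕ Option Bool}

/-- Merging the circle into the component of `s` forgets which of the new segments lie on the
circle. Hence the label depends neither on `g` nor on `onCircle`, and it can be compared between
different resolutions of the kink. -/
theorem mergeCircle_comps_symm (h : SplitsCircle f g s c onCircle N)
    (e : ((Option V × Bool) ⊕ Option L) ⊕ Fin n) :
    Smoothing.mergeCircle ⟨_, f⟩ (Smoothing.comp ⟨_, f⟩ s)
      (h.comps.symm (Smoothing.comp ⟨_, g⟩ e)) = kinkLabel f s e := by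
  obtain ⟨y, rfl⟩ := (split V L n).symm.surjective e
  show Smoothing.mergeCircle _ _ (Sum.elim _ _ (split V L n ((split V L n).symm y))) =
    Sum.elim _ _ (split V L n ((split V L n).symm y))
  rw [Equiv.apply_symm_apply]
  rcases y with e | o
  · exact Smoothing.mergeCircle_toAddCircle _ _ _
  · cases ho : onCircle o
    · rw [Sum.elim_inr, Sum.elim_inr, ho]
      exact Smoothing.mergeCircle_toAddCircle _ _ _
    · rw [Sum.elim_inr, Sum.elim_inr, ho]
      rfl

/-- By the previous lemma the label factors through the components of the resolution, so it is
constant along them. -/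
theorem kinkLabel_next (h : SplitsCircle f g s c onCircle N)
    (e : ((Option V × Bool) ⊕ Option L) ⊕ Fin n) (x : (Option V × Bool) ⊕ Option L)
    (he : g e = Sum.inl x) : kinkLabel f s e = kinkLabel f s (Sum.inl x) := by
  rw [← h.mergeCircle_comps_symm, ← h.mergeCircle_comps_symm, Smoothing.comp_eq ⟨_, g⟩ he]

theorem comps_cases (h : SplitsCircle f g s c onCircle N) (q : (Smoothing.mk _ g).Comp) :
    q = h.comps (Smoothing.newCircle ⟨_, f⟩) ∨
      ∃ q', q = h.comps (Smoothing.toAddCircle ⟨_, f⟩ q') := by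
  rcases Smoothing.addCircle_cases ⟨_, f⟩ (h.comps.symm q) with hq | ⟨e, hq⟩
  · exact Or.inl ((Equiv.symm_apply_eq _).1 hq)
  · exact Or.inr ⟨_, (Equiv.symm_apply_eq _).1 hq⟩

/-- One of the segments `s'` and `t'` is on the circle, and the other one on the component of `s`. -/
def Joins (h : SplitsCircle f g s c onCircle N) (s' t' : ((Option V × Bool) ⊕ Option L) ⊕ Fin n) :
    Prop :=
  (Smoothing.comp ⟨_, g⟩ s' = h.comps (Smoothing.newCircle ⟨_, f⟩) ∧ Smoothing.comp ⟨_, g⟩ t' =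
    h.comps (Smoothing.toAddCircle ⟨_, f⟩ (Smoothing.comp ⟨_, f⟩ s))) ∨
  (Smoothing.comp ⟨_, g⟩ t' = h.comps (Smoothing.newCircle ⟨_, f⟩) ∧ Smoothing.comp ⟨_, g⟩ s' =
    h.comps (Smoothing.toAddCircle ⟨_, f⟩ (Smoothing.comp ⟨_, f⟩ s)))

theorem comp_new (h : SplitsCircle f g s c onCircle N) {o : Option Bool} (ho : onCircle o = true) :
    Smoothing.comp ⟨_, g⟩ ((split V L n).symm (Sum.inr o)) =
      h.comps (Smoothing.newCircle ⟨_, f⟩) := by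
  rw [h.connected, ho]
  rfl

theorem comp_edge (h : SplitsCircle f g s c onCircle N) :
    Smoothing.comp ⟨_, g⟩ ((split V L n).symm (Sum.inl s)) =
      h.comps (Smoothing.toAddCircle ⟨_, f⟩ (Smoothing.comp ⟨_, f⟩ s)) :=
  (Smoothing.addCircleLift_toAddCircle ⟨_, f⟩ _ _ h.comp_old s).symm

theorem comp_arc (h : SplitsCircle f g s c onCircle N) {o : Option Bool} (ho : onCircle o = false) :
    Smoothing.comp ⟨_, g⟩ ((split V L n).symm (Sum.inr o)) =
      h.comps (Smoothing.toAddCircle ⟨_, f⟩ (Smoothing.comp ⟨_, f⟩ s)) := by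
  rw [h.connected, ho]
  exact h.comp_edge

/-- Merging the circle sends both components named in `Joins` to the component of `s`. Equality of
the two labels is what allows the labelling to pass through the surgery. -/
theorem Joins.label {h : SplitsCircle f g s c onCircle N}
    {s' t' : ((Option V × Bool) ⊕ Option L) ⊕ Fin n} (hj : h.Joins s' t') :
    kinkLabel f s s' = Smoothing.comp ⟨_, f⟩ s ∧ kinkLabel f s t' = Smoothing.comp ⟨_, f⟩ s := by
  rw [← h.mergeCircle_comps_symm, ← h.mergeCircle_comps_symm]
  rcases hj with ⟨h1, h2⟩ | ⟨h1, h2⟩ <;> rw [h1, h2, Equiv.symm_apply_apply, Equiv.symm_apply_apply]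
  · exact ⟨rfl, Smoothing.mergeCircle_toAddCircle _ _ _⟩
  · exact ⟨Smoothing.mergeCircle_toAddCircle _ _ _, rfl⟩

/-- The saddle that merges the circle of a kink with the edge of the kink cancels the birth of the
circle. -/
theorem birth_cylinder_saddle (h : SplitsCircle f g s c onCircle N)
    {m : ((Option V × Bool) ⊕ Option L) ⊕ Fin n ≃ ((Option V × Bool) ⊕ Option L) ⊕ Fin n}
    {s' t' : ((Option V × Bool) ⊕ Option L) ⊕ Fin n} (k : IsSurgery g m s' t')
    (hj : h.Joins s' t')
    (hm : ∀ e x, m e = Sum.inl x → kinkLabel f s e = kinkLabel f s (Sum.inl x)) :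
    ((Cob.birth ⟨_, f⟩ ≫ h.cylinder) ≫ Cob.saddle g m s' t' k).1 =
      ⟦PreCob.labelled ⟨_, f⟩ ⟨_, m⟩ (Smoothing.compLift ⟨_, m⟩ (kinkLabel f s) hm)⟧ := by
  have hst := hj.label.1.trans hj.label.2.symm
  have hσ : PreCob.comp (PreCob.capped ⟨_, f⟩ ⟨_, g⟩
      (fun q => h.comps (Smoothing.toAddCircle ⟨_, f⟩ q)) (h.comps (Smoothing.newCircle ⟨_, f⟩)))
      (PreCob.saddle g m s' t' k) ≈
      PreCob.labelled ⟨_, f⟩ ⟨_, m⟩ (Smoothing.compLift ⟨_, m⟩ (kinkLabel f s) hm) := by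
    refine PreCob.capped_comp _ _ (Smoothing.comp ⟨_, f⟩ s)
      -- The retraction `ρ` undoes the isotopy and merges the circle into the component of `s`; on
      -- components of the saddle the same map is induced by the labels.
      (fun q => Smoothing.mergeCircle ⟨_, f⟩ (Smoothing.comp ⟨_, f⟩ s) (h.comps.symm q)) _ _
      (PreCob.saddleLift k (kinkLabel f s) hst h.kinkLabel_next) (fun q => ?_) ?_ h.comps_cases
      (fun q => ?_) (fun q => ?_) (PreCob.saddle_source_surjective k) ?_ ?_ rfl
    · rw [Equiv.symm_apply_apply]
      exact Smoothing.mergeCircle_toAddCircle _ _ _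
    · rw [Equiv.symm_apply_apply]
      rfl
    · induction q using Quot.ind with | _ e => exact (h.mergeCircle_comps_symm e).symm
    · induction q using Quot.ind with | _ e => rfl
    -- The band identifies the components of its two feet; the two cases only differ in the
    -- direction of the identification.
    · rcases hj with ⟨h1, h2⟩ | ⟨h1, h2⟩ <;> rw [← h1, ← h2]
      · exact Quot.sound (Or.inr ⟨rfl, rfl⟩)
      · exact Eq.symm (Quot.sound (Or.inr ⟨rfl, rfl⟩))
    · rw [PreCob.saddle_euler, hj.label.1]
      refine congrArg (· - _) (Smoothing.euler_mapDomain _ _ _ fun i => rfl)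
  exact Quotient.sound (Setoid.trans (PreCob.comp_congr
    (PreCob.birth_comp_cylinder _ _ _) (Setoid.refl _)) hσ)

/-- The saddle that splits off the circle of a kink from the edge of the kink cancels the death of
the circle. -/
theorem saddle_cylinderInv_death (h : SplitsCircle f g s c onCircle N)
    {m : ((Option V × Bool) ⊕ Option L) ⊕ Fin n ≃ ((Option V × Bool) ⊕ Option L) ⊕ Fin n}
    {s' t' : ((Option V × Bool) ⊕ Option L) ⊕ Fin n} (k : IsSurgery m g s' t')
    (hj : h.Joins s' t')
    (hm : ∀ e x, m e = Sum.inl x → kinkLabel f s e = kinkLabel f s (Sum.inl x)) :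
    (Cob.saddle m g s' t' k ≫ h.cylinderInv ≫ Cob.death ⟨_, f⟩).1 =
      ⟦PreCob.labelledRev ⟨_, f⟩ ⟨_, m⟩ (Smoothing.compLift ⟨_, m⟩ (kinkLabel f s) hm)⟧ := by
  have hst := hj.label.1.trans hj.label.2.symm
  have hσ : PreCob.comp (PreCob.saddle m g s' t' k) (PreCob.cappedRev ⟨_, f⟩ ⟨_, g⟩
      (fun q => h.comps (Smoothing.toAddCircle ⟨_, f⟩ q)) (h.comps (Smoothing.newCircle ⟨_, f⟩))) ≈
      PreCob.labelledRev ⟨_, f⟩ ⟨_, m⟩ (Smoothing.compLift ⟨_, m⟩ (kinkLabel f s) hm) := by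
    refine PreCob.comp_cappedRev _ _ (Smoothing.comp ⟨_, f⟩ s)
      (fun q => Smoothing.mergeCircle ⟨_, f⟩ (Smoothing.comp ⟨_, f⟩ s) (h.comps.symm q)) _ _
      -- The saddle now starts at `m`, so the invariance of labels is needed along `m` instead of
      -- along `g`.
      (PreCob.saddleLift k (kinkLabel f s) hst hm) (fun q => ?_) ?_ h.comps_cases
      (fun q => ?_) (fun q => ?_) (PreCob.saddle_target_surjective k) ?_ ?_ rfl
    · rw [Equiv.symm_apply_apply]
      exact Smoothing.mergeCircle_toAddCircle _ _ _
    · rw [Equiv.symm_apply_apply]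
      rfl
    · induction q using Quot.ind with | _ e => rfl
    · induction q using Quot.ind with | _ e => exact (h.mergeCircle_comps_symm e).symm
    · rcases hj with ⟨h1, h2⟩ | ⟨h1, h2⟩ <;> rw [← h1, ← h2]
      · exact Quot.sound (Or.inr ⟨rfl, rfl⟩)
      · exact Eq.symm (Quot.sound (Or.inr ⟨rfl, rfl⟩))
    · rw [PreCob.saddle_euler, hj.label.1]
      refine congrArg (· - _) (Smoothing.euler_mapDomain _ _ _ fun i => rfl)
  exact Quotient.sound (Setoid.trans (PreCob.comp_congr (Setoid.refl _)
    (PreCob.cylinder_comp_death _ _ h.comps h.comps_source)) hσ)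

/-- The birth of a circle, a saddle merging it with an edge, a saddle splitting off a circle from
this edge, and the death of the latter circle compose to the identity. -/
theorem birth_saddle_saddle_death (h : SplitsCircle f g s c onCircle N)
    {g' : ((Option V × Bool) ⊕ Option L) ⊕ Fin n ≃ ((Option V × Bool) ⊕ Option L) ⊕ Fin n}
    {c' : Option Bool} {onCircle' : Option Bool → Bool}
    {N' : (((V × Bool) ⊕ L) ⊕ Fin n) ⊕ Option Bool → (((V × Bool) ⊕ L) ⊕ Fin n) ⊕ Option Bool}
    (h' : SplitsCircle f g' s c' onCircle' N')
    {m : ((Option V × Bool) ⊕ Option L) ⊕ Fin n ≃ ((Option V × Bool) ⊕ Option L) ⊕ Fin n}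
    {s₁ t₁ s₂ t₂ : ((Option V × Bool) ⊕ Option L) ⊕ Fin n} (k : IsSurgery g m s₁ t₁)
    (k' : IsSurgery m g' s₂ t₂) (hj : h.Joins s₁ t₁) (hj' : h'.Joins s₂ t₂) :
    (Cob.birth ⟨_, f⟩ ≫ h.cylinder) ≫ Cob.saddle g m s₁ t₁ k ≫ Cob.saddle m g' s₂ t₂ k' ≫
      h'.cylinderInv ≫ Cob.death ⟨_, f⟩ = 𝟙 _ := by
  -- The intermediate manifold `m` inherits the labelling from `g` by surgery. Both halves use this
  -- one labelling, so they are a product and its reverse.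
  have hm := k.label (hj.label.1.trans hj.label.2.symm) h.kinkLabel_next
  have h1 := h.birth_cylinder_saddle k hj hm
  have h2 := h'.saddle_cylinderInv_death k' hj' hm
  -- The composite is cut at `m`: birth and first saddle on one side, second saddle and death on the
  -- other.
  rw [← Category.assoc]
  refine Subtype.ext ((congrArg₂ VirtCob.comp h1 h2).trans (Quotient.sound
    (PreCob.labelled_comp_labelledRev _ _ _ ?_ ?_)))
  · intro q
    induction q using Quot.ind with | _ e =>
    -- Each old segment survives in the kinked diagram with its own component as label, so every
    -- component occurs as a label.
    refine ⟨Smoothing.comp ⟨_, m⟩ ((split V L n).symm (Sum.inl e)), ?_⟩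
    show Sum.elim _ _ (split V L n ((split V L n).symm _)) = _
    rw [Equiv.apply_symm_apply]
    rfl
  · exact Smoothing.euler_mapDomain _ _ _ fun i => rfl

end SplitsCircle

end Diagram

/-! ## Functoriality of the additive enlargement -/

theorem lin_comp {a b c : Smoothing n} (f : a ⟶ b) (g : b ⟶ c) :
    lin (f ≫ g) = lin f ≫ lin g :=
  (Free.embedding F₂ (Smoothing n)).map_comp f g

theorem cls_comp {a b c : Smoothing n} (f : a ⟶ b) (g : b ⟶ c) :
    cls (f ≫ g) = cls f ≫ cls g := by
  rw [cls, lin_comp]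
  exact CategoryTheory.Functor.map_comp _ _ _

theorem cls_id (a : Smoothing n) : cls (𝟙 a) = 𝟙 (toLoc a) := by
  have h : lin (𝟙 a) = 𝟙 (Free.of F₂ a) := (Free.embedding F₂ (Smoothing n)).map_id a
  rw [cls, h]
  exact CategoryTheory.Functor.map_id _ _

theorem tmul_comp {A B C : TensObj n} (u : A.X ⟶ B.X) (v : B.X ⟶ C.X)
    (φ : A.V.carrier →ₗ[F₂] B.V.carrier) (ψ : B.V.carrier →ₗ[F₂] C.V.carrier) :
    tmul u φ ≫ tmul v ψ = (tmul (u ≫ v) (ψ ∘ₗ φ) : A ⟶ C) :=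
  rfl

theorem tensorEntry_add {A B : TensObj n} {V W : GrVect} (φ : V.carrier →ₗ[F₂] W.carrier)
    (f g : A ⟶ B) : tensorEntry φ (f + g) = tensorEntry φ f + tensorEntry φ g :=
  map_add _ _ _

theorem tensorEntry_zero {A B : TensObj n} {V W : GrVect} (φ : V.carrier →ₗ[F₂] W.carrier) :
    tensorEntry φ (0 : A ⟶ B) = 0 :=
  map_zero _

/-- The interchange law. Both sides are bilinear in `f` and `g`, so it reduces to pure tensors,
where it is the functoriality of the tensor product of linear maps. -/
theorem tensorEntry_comp {A B C : TensObj n} {V W Z : GrVect} (φ : V.carrier →ₗ[F₂] W.carrier)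
    (ψ : W.carrier →ₗ[F₂] Z.carrier) (f : A ⟶ B) (g : B ⟶ C) :
    tensorEntry φ f ≫ tensorEntry ψ g = tensorEntry (ψ ∘ₗ φ) (f ≫ g) := by
  induction f using TensorProduct.induction_on with
  | zero =>
    exact (congrArg (· ≫ _) (tensorEntry_zero φ)).trans (Limits.zero_comp.trans
      ((congrArg _ Limits.zero_comp).trans (tensorEntry_zero _)).symm)
  | add f f' hf hf' =>
    refine (congrArg (· ≫ _) (tensorEntry_add φ f f')).trans ((Preadditive.add_comp _ _ _ _ _ _).trans
      ((congrArg₂ _ hf hf').trans ?_))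
    exact ((congrArg _ (Preadditive.add_comp _ _ _ f f' g)).trans (tensorEntry_add _ _ _)).symm
  | tmul u α =>
    induction g using TensorProduct.induction_on with
    | zero =>
      exact (congrArg (_ ≫ ·) (tensorEntry_zero ψ)).trans (Limits.comp_zero.trans
        ((congrArg _ Limits.comp_zero).trans (tensorEntry_zero _)).symm)
    | add g g' hg hg' =>
      refine (congrArg (_ ≫ ·) (tensorEntry_add ψ g g')).trans
        ((Preadditive.comp_add _ _ _ _ _ _).trans ((congrArg₂ _ hg hg').trans ?_))
      exact ((congrArg _ (Preadditive.comp_add _ _ _ (tmul u α) g g')).trans (tensorEntry_add _ _ _)).symm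
    | tmul v β =>
      refine (tmul_comp (A := ⟨A.X, A.V.tensor V⟩) (B := ⟨B.X, B.V.tensor W⟩)
        (C := ⟨C.X, C.V.tensor Z⟩) u v (TensorProduct.map α φ) (TensorProduct.map β ψ)).trans
        (Eq.trans ?_ (congrArg (tensorEntry (ψ ∘ₗ φ)) (tmul_comp u v α β)).symm)
      exact congrArg (tmul (A := ⟨A.X, A.V.tensor V⟩) (B := ⟨C.X, C.V.tensor Z⟩) (u ≫ v))
        (TensorProduct.map_comp β ψ α φ).symm

theorem tensorHom_comp {C D F : BN n} {V W Z : GrVect} (f : C ⟶ D) (g : D ⟶ F)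
    (φ : V.carrier →ₗ[F₂] W.carrier) (ψ : W.carrier →ₗ[F₂] Z.carrier) :
    tensorHom f φ ≫ tensorHom g ψ = tensorHom (f ≫ g) (ψ ∘ₗ φ) := by
  funext i k
  refine (Finset.sum_congr rfl fun j _ => tensorEntry_comp φ ψ (f i j) (g j k)).trans ?_
  -- For fixed `ψ ∘ φ`, tensoring is linear in the cobordism factor, so it commutes with the sum
  -- over intermediate summands.
  exact (map_sum (TensorProduct.map LinearMap.id ((TensorProduct.mapBilinear (RingHom.id F₂) _ _ _
    _).flip (ψ ∘ₗ φ))) (fun j => f i j ≫ g j k) Finset.univ).symm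

theorem tensorHom_zero {C D : BN n} {V W : GrVect} (φ : V.carrier →ₗ[F₂] W.carrier) :
    tensorHom (0 : C ⟶ D) φ = 0 := by
  funext i j
  exact tensorEntry_zero φ

/-- The two maps act on different factors of `RX ⊗ Ξ`. -/
theorem mulR_comp_xi (r : RX) : mulR r ∘ₗ xi = xi ∘ₗ mulR r :=
  (TensorProduct.map_comp (LinearMap.mulLeft F₂ r) LinearMap.id LinearMap.id mulXi).symm.trans
    (TensorProduct.map_comp LinearMap.id mulXi (LinearMap.mulLeft F₂ r) LinearMap.id)

/-- `1 ⊗ ξ` commutes with each of the three summands separately, whatever `d` and `ρ` are: it meets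
only identities, itself, and `mulR r`. -/
theorem tensorHom_xi_comm {C : BN n} (d ρ : C ⟶ C) (r : RX) :
    tensorHom (𝟙 C) xi ≫ (tensorHom d LinearMap.id + (tensorHom ρ xi +
      tensorHom (𝟙 C) (xi ∘ₗ mulR r))) = (tensorHom d LinearMap.id + (tensorHom ρ xi +
      tensorHom (𝟙 C) (xi ∘ₗ mulR r))) ≫ tensorHom (𝟙 C) xi := by
  simp only [Preadditive.comp_add, Preadditive.add_comp, tensorHom_comp, Category.id_comp,
    Category.comp_id, LinearMap.id_comp, LinearMap.comp_id, LinearMap.comp_assoc, mulR_comp_xi]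

theorem PTangle.mulXi_comp_differential {E : Ends} (P : PTangle E) :
    P.mulXi ≫ P.differential = P.differential ≫ P.mulXi :=
  tensorHom_xi_comm P.tangle.d P.rho RX.x

theorem PTangle.mulXi_comp_act {E : Ends} (P : PTangle E) (r : RX) :
    P.mulXi ≫ P.act r = P.act r ≫ P.mulXi :=
  (tensorHom_comp _ _ _ _).trans ((congrArg _ (mulR_comp_xi r)).trans (tensorHom_comp _ _ _ _).symm)

namespace Tangle

variable {E : Ends}

theorem entry_comp {T T' T'' : Tangle E} {ε : T.V → Bool} {ε' : T'.V → Bool} {ε'' : T''.V → Bool}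
    (f : T.diagram.smoothing ε ⟶ T'.diagram.smoothing ε')
    (g : T'.diagram.smoothing ε' ⟶ T''.diagram.smoothing ε'') :
    entry f ≫ entry g = (entry (f ≫ g) : T.CBN.X ε ⟶ T''.CBN.X ε'') := by
  rw [entry, entry, entry, cls_comp]
  exact tmul_comp _ _ _ _

theorem entry_id (T : Tangle E) (ε : T.V → Bool) :
    (entry (𝟙 (T.diagram.smoothing ε)) : T.CBN.X ε ⟶ T.CBN.X ε) = 𝟙 _ := by
  rw [entry, cls_id]
  rfl

end Tangle

/-! ## The enhanced map of the movie -/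

/-- A row with a single nonzero entry leaves a single path in the matrix product. This turns sums
over resolutions into compositions of cobordisms. -/
theorem mat_comp_eq_single {C D F : BN n} (f : C ⟶ D) (g : D ⟶ F) {i : C.ι} (j : D.ι) (k : F.ι)
    (h : ∀ j', j' ≠ j → f i j' = 0) : (f ≫ g) i k = f i j ≫ g j k :=
  Finset.sum_eq_single (M := C.X i ⟶ F.X k) j
    (fun j' _ hj => by rw [h j' hj, Limits.zero_comp]) (fun hj => absurd (Finset.mem_univ j) hj)

/-- If the part of a composition without the homotopy of a slide vanishes, and the part with the
homotopy is the identity, then the composition of the enhanced maps is the multiplication by `ξ`. -/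
theorem tensorHom_slide {C D D' : BN n} (A : C ⟶ D) (S : D ⟶ D') (H : D' ⟶ D') (R : D' ⟶ C)
    (h0 : A ≫ S ≫ R = 0) (h1 : A ≫ S ≫ H ≫ R = 𝟙 C) :
    tensorHom A (LinearMap.id : grRXi.carrier →ₗ[F₂] grRXi.carrier) ≫
      tensorHom (𝟙 D) (LinearMap.id : grRXi.carrier →ₗ[F₂] grRXi.carrier) ≫
      tensorHom S (LinearMap.id : grRXi.carrier →ₗ[F₂] grRXi.carrier) ≫
      (tensorHom (𝟙 D') LinearMap.id + tensorHom H xi) ≫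
      tensorHom (𝟙 D') (LinearMap.id : grRXi.carrier →ₗ[F₂] grRXi.carrier) ≫
      tensorHom R (LinearMap.id : grRXi.carrier →ₗ[F₂] grRXi.carrier) ≫
      𝟙 (tensorObj C grRXi) = tensorHom (𝟙 C) xi := by
  simp only [Preadditive.comp_add, Preadditive.add_comp, tensorHom_comp, Category.id_comp,
    Category.comp_id, LinearMap.id_comp, LinearMap.comp_id, h0, h1, tensorHom_zero, zero_add]

/-! ### Matrix entries on the resolutions of the kink -/

namespace Tangle

variable {E : Ends} (T : Tangle E) (s : T.Edge) (ov : Bool)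

/-- The resolution of a diagram with a kink that is `b` at the kink and `ε` elsewhere. -/
def extendRes {V : Type} (ε : V → Bool) (b : Bool) : Option V → Bool := fun o => o.elim b ε

theorem eq_extendRes {V : Type} {ε : V → Bool} {ε' : Option V → Bool} {b : Bool}
    (h : ∀ v, ε' (some v) = ε v) (h' : ε' none = b) : ε' = extendRes ε b := by
  funext o
  rcases o with _ | v
  · exact h'
  · exact h v

theorem addKinkMap_eq_zero {ε : T.V → Bool} (ε' : Option T.V → Bool)
    (h : ε' ≠ extendRes ε true) : T.addKinkMap s ov ε ε' = 0 :=
  dif_neg fun h' => h (eq_extendRes h'.1 h'.2)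

theorem addKinkMap_extendRes (ε : T.V → Bool) :
    T.addKinkMap s ov ε (extendRes ε true) =
      entry (T' := T.negKink s ov) (ε' := extendRes ε true)
        (Cob.birth (T.diagram.smoothing ε) ≫
          (T.diagram.splits_negKink s ov (ε' := extendRes ε true) (fun _ => rfl) rfl).cylinder) :=
  dif_pos ⟨fun _ => rfl, rfl⟩

theorem saddleMap_eq_zero {s t : T.Edge} (hst : s ≠ t) (o : Orientation E (T.diagram.surger s t))
    {ε : T.V → Bool} (ε' : T.V → Bool) (h : ε' ≠ ε) : T.saddleMap hst o ε ε' = 0 :=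
  dif_neg fun h' => h h'.symm

theorem saddleMap_self {s t : T.Edge} (hst : s ≠ t) (o : Orientation E (T.diagram.surger s t))
    (ε : T.V → Bool) : T.saddleMap hst o ε ε =
      entry (T' := T.surger s t o) (ε' := ε) (T.diagram.saddle hst rfl) :=
  dif_pos rfl

/-- The maps on Bar-Natan's complexes of the movie that adds a negative kink, turns it into a
positive one, and removes it, and the same with the homotopy of a slide through the crossing. -/
theorem kink_cancel (a b : (T.negKink s ov).Edge) (hab : a ≠ b)
    (o : Orientation E ((T.negKink s ov).diagram.surger a b))
    {c : Option Bool} {onCircle : Option Bool → Bool}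
    {N : (T.V → Bool) → T.Edge ⊕ Option Bool → T.Edge ⊕ Option Bool}
    (hs : ∀ (ε : T.V → Bool) (ε' : Option T.V → Bool), (∀ v, ε' (some v) = ε v) → ε' none = false →
      Diagram.SplitsCircle (T.diagram.next.trans (Diagram.resolve E.n ε))
        (((T.diagram.kink s ov).surger a b).next.trans (Diagram.resolve E.n ε')) s c onCircle (N ε))
    (R : ((T.negKink s ov).surger a b o).CBN ⟶ T.CBN)
    (hR : R = fun (ε' : Option T.V → Bool) (ε : T.V → Bool) =>
      if h : (∀ v, ε' (some v) = ε v) ∧ ε' none = false then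
        entry (T := (T.negKink s ov).surger a b o) (ε := ε')
          ((hs ε ε' h.1 h.2).cylinderInv ≫ Cob.death (T.diagram.smoothing ε))
      else 0)
    (hj : ∀ ε : T.V → Bool, (T.diagram.splits_negKink s ov (ε := ε) (ε' := extendRes ε true)
      (fun _ => rfl) rfl).Joins a b)
    (hj' : ∀ ε : T.V → Bool, (hs ε (extendRes ε false) (fun _ => rfl) rfl).Joins
      (((T.diagram.kink s ov).surger a b).next.symm (Sum.inl (Sum.inl (none, false))))
      (((T.diagram.kink s ov).surger a b).next.symm (Sum.inl (Sum.inl (none, true))))) :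
    T.addKinkMap s ov ≫ (T.negKink s ov).saddleMap hab o ≫ R = 0 ∧
    T.addKinkMap s ov ≫ (T.negKink s ov).saddleMap hab o ≫
      ((T.negKink s ov).surger a b o).slideHomotopy none ≫ R = 𝟙 T.CBN := by
  -- From `ε` the birth reaches only the resolution that is `1` at the kink, and the saddle map is
  -- diagonal, so only one path enters `Y`.
  have hAS : ∀ {F : BN E.n} (Y : ((T.negKink s ov).surger a b o).CBN ⟶ F) (ε : T.V → Bool)
      (k : F.ι), (T.addKinkMap s ov ≫ (T.negKink s ov).saddleMap hab o ≫ Y) ε k =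
        T.addKinkMap s ov ε (extendRes ε true) ≫
          (T.negKink s ov).saddleMap hab o (extendRes ε true) (extendRes ε true) ≫
            Y (extendRes ε true) k := by
    intro F Y ε k
    refine (mat_comp_eq_single (T.addKinkMap s ov) _ (extendRes ε true) k
      (fun ε' h => T.addKinkMap_eq_zero s ov ε' h)).trans (congrArg (_ ≫ ·) ?_)
    exact mat_comp_eq_single ((T.negKink s ov).saddleMap hab o) Y (extendRes ε true) k
      (fun ε' h => (T.negKink s ov).saddleMap_eq_zero hab o ε' h)
  constructor
  · funext ε k
    refine (hAS R ε k).trans ?_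
    -- The death lives on resolutions that are `0` at the kink; the path has not left the value `1`.
    have h0 : R (extendRes ε true) k = 0 := by
      rw [hR]
      exact dif_neg fun h => Bool.noConfusion h.2
    rw [h0]
    exact (congrArg (_ ≫ ·) Limits.comp_zero).trans Limits.comp_zero
  · funext ε k
    refine (hAS _ ε k).trans ?_
    -- The homotopy changes the new crossing from `1` to `0` and fixes all other crossings, which
    -- determines its target.
    have hH : (((T.negKink s ov).surger a b o).slideHomotopy none ≫ R) (extendRes ε true) k =
        ((T.negKink s ov).surger a b o).slideHomotopy none (extendRes ε true) (extendRes ε false) ≫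
          R (extendRes ε false) k := by
      refine mat_comp_eq_single (((T.negKink s ov).surger a b o).slideHomotopy none) R
        (extendRes ε false) k (fun ε' h => dif_neg fun h' => h ?_)
      exact eq_extendRes (fun v => h'.1.2 (some v) (Option.some_ne_none v)) h'.1.1
    rw [hH]
    have hflip : (extendRes ε false none = !extendRes ε true none) ∧
        ∀ w, w ≠ none → extendRes ε false w = extendRes ε true w := by
      refine ⟨rfl, fun w hw => ?_⟩
      rcases w with _ | w
      · exact absurd rfl hw
      · rfl
    have hH' : ((T.negKink s ov).surger a b o).slideHomotopy none (extendRes ε true)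
        (extendRes ε false) = entry (T := (T.negKink s ov).surger a b o)
          (T' := (T.negKink s ov).surger a b o) (ε := extendRes ε true) (ε' := extendRes ε false)
          (((T.negKink s ov).surger a b o).diagram.flip none hflip.1 hflip.2) :=
      dif_pos ⟨hflip, rfl⟩
    -- On the diagonal the four cobordisms cancel; off the diagonal `R` vanishes, since it preserves
    -- the resolution of the old crossings.
    by_cases hk : ε = k
    · subst hk
      have hR' : R (extendRes ε false) ε = entry (T := (T.negKink s ov).surger a b o)
          (ε := extendRes ε false) ((hs ε (extendRes ε false) (fun _ => rfl) rfl).cylinderInv ≫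
            Cob.death (T.diagram.smoothing ε)) := by
        rw [hR]
        exact dif_pos ⟨fun _ => rfl, rfl⟩
      rw [hH', hR']
      have hA := T.addKinkMap_extendRes s ov ε
      have hS := (T.negKink s ov).saddleMap_self hab o (extendRes ε true)
      refine (congrArg₂ (· ≫ ·) hA (congrArg₂ (· ≫ ·) hS (entry_comp _ _))).trans ?_
      refine (congrArg (_ ≫ ·) (entry_comp _ _)).trans ((entry_comp _ _).trans ?_)
      refine Eq.trans (congrArg entry ?_) ((entry_id T ε).trans (Mat_.id_apply_self T.CBN ε).symm)
      exact (T.diagram.splits_negKink s ov (ε := ε) (ε' := extendRes ε true)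
        (fun _ => rfl) rfl).birth_saddle_saddle_death (hs ε (extendRes ε false) (fun _ => rfl) rfl)
        _ _ (hj ε) (hj' ε)
    · have hR' : R (extendRes ε false) k = 0 := by
        rw [hR]
        exact dif_neg fun h => hk (funext h.1)
      rw [hR']
      refine (congrArg (_ ≫ ·) ((congrArg (_ ≫ ·) Limits.comp_zero).trans
        Limits.comp_zero)).trans (Limits.comp_zero.trans ?_)
      exact (Mat_.id_apply_of_ne T.CBN ε k hk).symm

/-! ### Feet of the slide saddle, and the two movies -/

/-- The saddle `flip` at a crossing has its feet on the two edges entering the crossing. This lemma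
and the next three find these edges at the new crossing, for the two positive kinks. -/
theorem posKinkOut_next_symm_false : ((T.diagram.kink s ov).surger (T.diagram.out s ov false) (T.diagram.out s ov true)).next.symm
    (Sum.inl (Sum.inl (none, false))) = T.diagram.embed s ov s :=
  (swap_trans_symm _ _ (Sum.inr (some false)) (Sum.inr (some true)) (Sum.inr (some false))).trans rfl

theorem posKinkOut_next_symm_true : ((T.diagram.kink s ov).surger (T.diagram.out s ov false) (T.diagram.out s ov true)).next.symm
    (Sum.inl (Sum.inl (none, true))) = T.diagram.loop s ov :=
  (swap_trans_symm _ _ (Sum.inr (some false)) (Sum.inr (some true)) (Sum.inr (some true))).trans rfl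

theorem posKinkIn_next_symm_false : ((T.diagram.kink s ov).surger (T.diagram.embed s ov s) (T.diagram.out s ov false)).next.symm
    (Sum.inl (Sum.inl (none, false))) = T.diagram.out s ov false :=
  (swap_trans_symm _ _ (Sum.inl s) (Sum.inr (some false)) (Sum.inr (some false))).trans
    (congrArg (Diagram.split _ _ _).symm (Equiv.swap_apply_left _ _))

theorem posKinkIn_next_symm_true : ((T.diagram.kink s ov).surger (T.diagram.embed s ov s) (T.diagram.out s ov false)).next.symm
    (Sum.inl (Sum.inl (none, true))) = T.diagram.loop s ov :=
  (swap_trans_symm _ _ (Sum.inl s) (Sum.inr (some false)) (Sum.inr (some true))).trans rfl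

theorem rp2Movie_false_Dbar :
    (T.rp2Movie s ov false).Dbar = (⟨T, 0⟩ : PTangle E).mulXi := by
  -- `posKinkOut` is by definition the surgered negative kink, so its removal map has the required
  -- form. In the negative kink the first foot of the band is on the circle and the second one on
  -- the edge that leaves the kink.
  have h := T.kink_cancel s ov (T.diagram.out s ov false) (T.diagram.out s ov true)
    (T.out_ne_out s ov) (T.posKinkOut s ov).orientation
    (fun ε ε' h h' => T.diagram.splits_posKinkOut s ov h h') (T.removeKinkOutMap s ov) rfl
    (fun ε => Or.inl ⟨Diagram.SplitsCircle.comp_new _ rfl, Diagram.SplitsCircle.comp_arc _ rfl⟩)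
    (fun ε => Or.inr ⟨?_, ?_⟩)
  -- The enhanced map of the movie unfolds to exactly this composition: the cup and the cap are the
  -- inner identities, the empty movie is the last one.
  · exact tensorHom_slide _ _ _ _ h.1 h.2
  -- In the `0`-resolution of this positive kink the loop edge is on the circle, while `s` is not.
  · refine (congrArg _ (T.posKinkOut_next_symm_true s ov)).trans
      (Diagram.SplitsCircle.comp_new (o := none) _ rfl)
  · refine (congrArg _ (T.posKinkOut_next_symm_false s ov)).trans
      (Diagram.SplitsCircle.comp_edge _)

theorem rp2Movie_true_Dbar :
    (T.rp2Movie s ov true).Dbar = (⟨T, 0⟩ : PTangle E).mulXi := by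
  -- With the other foot at the entrance, the roles are exchanged: the second foot of the band is on
  -- the circle. After the surgery `out false` alone is the circle, and the loop edge belongs to the
  -- arc of `s`.
  have h := T.kink_cancel s ov (T.diagram.embed s ov s) (T.diagram.out s ov false)
    (T.embed_ne_out s ov false) (T.posKinkIn s ov).orientation
    (fun ε ε' h h' => T.diagram.splits_posKinkIn s ov h h') (T.removeKinkInMap s ov) rfl
    (fun ε => Or.inr ⟨Diagram.SplitsCircle.comp_new _ rfl, Diagram.SplitsCircle.comp_edge _⟩)
    (fun ε => Or.inl ⟨?_, ?_⟩)
  · exact tensorHom_slide _ _ _ _ h.1 h.2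
  · refine (congrArg _ (T.posKinkIn_next_symm_false s ov)).trans
      (Diagram.SplitsCircle.comp_new (o := some false) _ rfl)
  · refine (congrArg _ (T.posKinkIn_next_symm_true s ov)).trans
      (Diagram.SplitsCircle.comp_arc (o := none) _ rfl)

end Tangle

end
end BNTangle

open CategoryTheory BNTangle in
/-- Let `T` be an oriented tangle diagram without basepoints, and consider the movie of the connected
sum of `I × T` with the standard `ℝP²` with Euler number `-2`, decorated by its core, at the edge
`s`. The enhanced map of this movie is equal to the multiplication by `ξ` on
`C_BN(T) ⊗ RX ⊗ Ξ`; it is an `RX`-linear chain map. -/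
theorem lemma5p1 (E : BNTangle.Ends) (T : BNTangle.Tangle E) (hT : T.diagram.Planar)
    (s : T.Edge) (ov foot : Bool) :
    (T.rp2Movie s ov foot).Dbar = (⟨T, 0⟩ : PTangle E).mulXi ∧
    (T.rp2Movie s ov foot).Dbar ≫ (⟨T, 0⟩ : PTangle E).differential =
      (⟨T, 0⟩ : PTangle E).differential ≫ (T.rp2Movie s ov foot).Dbar ∧
    ∀ r : RX, (T.rp2Movie s ov foot).Dbar ≫ (⟨T, 0⟩ : PTangle E).act r =
      (⟨T, 0⟩ : PTangle E).act r ≫ (T.rp2Movie s ov foot).Dbar := by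
  have h : (T.rp2Movie s ov foot).Dbar = (⟨T, 0⟩ : PTangle E).mulXi := by
    cases foot
    · exact T.rp2Movie_false_Dbar s ov
    · exact T.rp2Movie_true_Dbar s ov
  -- The remaining claims now concern multiplication by `ξ` only; no step of the movie has to be
  -- checked for compatibility with the differential or with `RX`.
  rw [h]
  exact ⟨rfl, PTangle.mulXi_comp_differential _, PTangle.mulXi_comp_act _⟩
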